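/- Theorem 1. Let $H$ be a separable infinite-dimensional real Hilbert space, $X$ a random element of $H$ defined on a probability space, and $x_0\in H$ fixed. A function $f$ is called $\Gamma$-varying at $0$ with auxiliary function $\rho$ if $\rho$ is measurable and positive (near $0^+$) and $\lim_{h\to0^+} f(h+\rho(h)x)/f(h)=e^{x}$ for every $x\in\mathbb R$. Assume: (A1) There is an orthonormal basis $(e_p)_{p\in\mathbb N}$ of $H$ such that the real random variables $\langle X,e_p\rangle$, $p\in\mathbb N$, are independent and each has a density $f_p$ which is twice differentiable at $\langle x_0,e_p\rangle$ with $f_p$, $f_p'$ and $f_p''$ all nonzero at this point. Moreover $\|X-x_0\|$ has a density in a neighbourhood of $0$, and this density is $\Gamma$-varying at $0$ with auxiliary function $\rho$. (A2) The kernel $K:[0,\infty)\to[0,\infty)$ satisfies $\int_0^\infty K(s)\,ds=1$, is bounded, is supported in $[0,1]$, $K(1)>0$, and $K$ is differentiable on $[0,1]$ (one-sidedly at the end points) with $\sup_{s\in[0,1]}|K'(s)|<\infty$. For $h>0$ let $\Gamma_K(h)=\mathbb E\big[K\big(\tfrac{\|X-x_0\|}{h}\big)\,(X-x_0)\otimes(X-x_0)\big]$,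 a Bochner integral of operators, where $(u\otimes v)(t)=\langle u,t\rangle v$. Put $$v(h)=\mathbb E\Big[K\Big(\tfrac{\|X-x_0\|}{h}\Big)\|X-x_0\|\,\rho(\|X-x_0\|)\Big],\qquad w(h)=\mathbb E\Big[K\Big(\tfrac{\|X-x_0\|}{h}\Big)\|X-x_0\|^2\rho(\|X-x_0\|)^2\Big].$$ Then $\Gamma_K(h)$ is well defined for every $h>0$; $v(h)$ and $w(h)$ are well defined, finite and nonnegative for all sufficiently small $h>0$; $\Gamma_K(h)\to0$ in operator norm as $h\to0^+$; and for all fixed $i,j\in\mathbb N$, as $h\to0^+$, $$\langle\Gamma_K(h)e_i,e_j\rangle\sim v(h)\,\delta_{ij}+w(h)\,\mathcal R_{ij},$$ where $a\sim b$ means $a-b=o(b)$, $\mathcal R_{ii}=\dfrac{f_i''(\langle x_0,e_i\rangle)}{f_i(\langle x_0,e_i\rangle)}$ and $\mathcal R_{ij}=\dfrac{f_i'(\langle x_0,e_i\rangle)}{f_i(\langle x_0,e_i\rangle)}\,\dfrac{f_j'(\langle x_0,e_j\rangle)}{f_j(\langle x_0,e_j\rangle)}$ for $i\ne j$. -/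

import Mathlib

open MeasureTheory ProbabilityTheory Filter Topology Asymptotics

noncomputable section

namespace LocalPCA

/-- `f` is `Γ`-varying at `0` with auxiliary function `ρ`: the function `ρ` is measurable and
positive (on a right neighbourhood of `0`, the only place where it matters), and
`f (h + ρ h * x) / f h → exp x` as `h → 0⁺`, for every real `x`. -/
structure IsGammaVaryingAtZero (f ρ : ℝ → ℝ) : Prop where
  measurable_aux : Measurable ρ
  aux_pos : ∀ᶠ h in 𝓝[>] (0 : ℝ), 0 < ρ h
  tendsto : ∀ x : ℝ,
    Tendsto (fun h => f (h + ρ h * x) / f h) (𝓝[>] 0) (𝓝 (Real.exp x))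

/-- The real random variable `U` has the density `f` on the Borel set `s`: the law of `U`,
restricted to `s`, is the restriction to `s` of the measure with Lebesgue density `f`. -/
structure HasDensityOn {Ω : Type*} [MeasurableSpace Ω] (P : Measure Ω) (U : Ω → ℝ)
    (f : ℝ → ℝ) (s : Set ℝ) : Prop where
  measurable : Measurable f
  nonneg : ∀ t, 0 ≤ f t
  law_eq : (P.map U).restrict s =
    (volume.withDensity fun t => ENNReal.ofReal (f t)).restrict s

/-- Assumption on the random element `X` and the point `x₀`, relative to an orthonormal basis `e`:
the coordinates of `X` are independent with densities `f p`; each `f p` is twice differentiable at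
the `p`-th coordinate of `x₀`, where neither it nor its first two derivatives vanish; and
`‖X - x₀‖` has, in a neighbourhood of `0`, a density `g` which is `Γ`-varying at `0` with
auxiliary function `ρ`. -/
structure AssumptionOne {Ω : Type*} [MeasurableSpace Ω] (P : Measure Ω)
    {H : Type*} [NormedAddCommGroup H] [InnerProductSpace ℝ H]
    (X : Ω → H) (x₀ : H) (e : HilbertBasis ℕ ℝ H) (f : ℕ → ℝ → ℝ) (g ρ : ℝ → ℝ) : Prop where
  indep : iIndepFun (fun p ω => inner ℝ (X ω) (e p)) P
  density : ∀ p, HasDensityOn P (fun ω => inner ℝ (X ω) (e p)) (f p) Set.univ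
  differentiable : ∀ p, ∀ᶠ t in 𝓝 (inner ℝ x₀ (e p)), DifferentiableAt ℝ (f p) t
  differentiable_deriv : ∀ p, DifferentiableAt ℝ (deriv (f p)) (inner ℝ x₀ (e p))
  ne_zero : ∀ p, f p (inner ℝ x₀ (e p)) ≠ 0
  deriv_ne_zero : ∀ p, deriv (f p) (inner ℝ x₀ (e p)) ≠ 0
  deriv_deriv_ne_zero : ∀ p, deriv (deriv (f p)) (inner ℝ x₀ (e p)) ≠ 0
  density_norm : ∃ ε > 0, HasDensityOn P (fun ω => ‖X ω - x₀‖) g (Set.Iio ε)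
  gamma : IsGammaVaryingAtZero g ρ

/-- Assumption on the kernel: `K` is nonnegative on `[0, ∞)` with integral `1`, bounded, supported
in `[0, 1]`, with `K 1 > 0`, and differentiable on `[0, 1]` (one-sidedly at the end points) with
bounded derivative. Values of `K` on the negative axis are irrelevant. -/
structure AssumptionTwo (K : ℝ → ℝ) : Prop where
  nonneg : ∀ s, 0 ≤ s → 0 ≤ K s
  integral_eq_one : ∫ s in Set.Ici (0 : ℝ), K s = 1
  bounded : ∃ C, ∀ s, 0 ≤ s → K s ≤ C
  support : ∀ s, 1 < s → K s = 0
  one_pos : 0 < K 1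
  differentiable : DifferentiableOn ℝ K (Set.Icc 0 1)
  deriv_bounded : ∃ C, ∀ s ∈ Set.Icc (0 : ℝ) 1, |derivWithin K (Set.Icc 0 1) s| ≤ C

section

variable {Ω : Type*} [MeasurableSpace Ω] (P : Measure Ω)
  {H : Type*} [NormedAddCommGroup H] [InnerProductSpace ℝ H]

/-- The random operator `K(‖X - x₀‖ / h) (X - x₀) ⊗ (X - x₀)`, with `(u ⊗ v) t = ⟨u, t⟩ v`. -/
def localTensor (K : ℝ → ℝ) (X : Ω → H) (x₀ : H) (h : ℝ) (ω : Ω) : H →L[ℝ] H :=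
  K (‖X ω - x₀‖ / h) • InnerProductSpace.rankOne ℝ (X ω - x₀) (X ω - x₀)

/-- The theoretical local covariance operator of `X` at `x₀` with kernel `K` and bandwidth `h`
(an operator-valued Bochner expectation). -/
def localCov (K : ℝ → ℝ) (X : Ω → H) (x₀ : H) (h : ℝ) : H →L[ℝ] H :=
  ∫ ω, localTensor K X x₀ h ω ∂P

/-- The random variable `K(‖X - x₀‖ / h) ‖X - x₀‖ ρ(‖X - x₀‖)`. -/
def vInner (K ρ : ℝ → ℝ) (X : Ω → H) (x₀ : H) (h : ℝ) (ω : Ω) : ℝ :=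
  K (‖X ω - x₀‖ / h) * (‖X ω - x₀‖ * ρ ‖X ω - x₀‖)

/-- The random variable `K(‖X - x₀‖ / h) ‖X - x₀‖² ρ(‖X - x₀‖)²`. -/
def wInner (K ρ : ℝ → ℝ) (X : Ω → H) (x₀ : H) (h : ℝ) (ω : Ω) : ℝ :=
  K (‖X ω - x₀‖ / h) * (‖X ω - x₀‖ ^ 2 * ρ ‖X ω - x₀‖ ^ 2)

/-- `v(h)`, the expectation of `vInner`. -/
def v (K ρ : ℝ → ℝ) (X : Ω → H) (x₀ : H) (h : ℝ) : ℝ := ∫ ω, vInner K ρ X x₀ h ω ∂P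

/-- `w(h)`, the expectation of `wInner`. -/
def w (K ρ : ℝ → ℝ) (X : Ω → H) (x₀ : H) (h : ℝ) : ℝ := ∫ ω, wInner K ρ X x₀ h ω ∂P

/-- The infinite matrix `R`, with `R i i = f i'' / f i` and
`R i j = (f i' / f i) * (f j' / f j)` for `i ≠ j`, at the coordinates of `x₀`. -/
def R (f : ℕ → ℝ → ℝ) (x₀ : H) (e : HilbertBasis ℕ ℝ H) (i j : ℕ) : ℝ :=
  if i = j then
    deriv (deriv (f i)) (inner ℝ x₀ (e i)) / f i (inner ℝ x₀ (e i))
  else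
    (deriv (f i) (inner ℝ x₀ (e i)) / f i (inner ℝ x₀ (e i))) *
      (deriv (f j) (inner ℝ x₀ (e j)) / f j (inner ℝ x₀ (e j)))

end

end LocalPCA

end

/-! Fix `i ≠ j` and split `X - x₀` into its coordinates `y`, `z` along `e i`, `e j` and the squared
norm `s` of the rest. By independence the law of `(y, z, s)` is `p(y) q(z) dy dz ν(ds)`, and `‖X -
x₀‖ = √(y² + z² + s)`. Near the origin `p(y) q(z)` is close to the constant `c = p(0) q(0)`. Hence
`g` agrees almost everywhere, up to a factor tending to `1`, with `G(r) = 2πc r ν{√s < r}`, which is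
monotone. This monotonicity replaces any regularity of `g`.

The comparison makes `G` itself `Γ`-varying with auxiliary function `ρ`, and forces `ρ(h) = o(h)`
because `G` vanishes on the left of `0`. For monotone `Γ`-varying functions the primitive of `G` is
equivalent to `ρ G`, and is again `Γ`-varying with the same `ρ`.

Polar coordinates in `(y, z)` now give the moments. Under `c dy dz ν(ds)` the weight `y²` has radial
density `r ∫₀ʳ G`, equivalent to `r ρ g`. The weight `y² z²` has radial density `r ∫₀ʳ t ∫₀ᵗ G`,
equivalent to `r² ρ² g`. Integrating against the kernel gives `v` and `w`. On the diagonal only `y²`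
is needed, and `w = o(v)` absorbs the term with `R i i`. Off the diagonal the ball is invariant
under `y ↦ -y` and `z ↦ -z`, so only the odd parts of `p` and `q` contribute to the moment of `y z`.
To first order these are `p'(0) y` and `q'(0) z`, whence `w` times `p' q' / (p q)`. -/

/-! ### Monotone Γ-varying functions and their primitives -/

/-- A monotone nonnegative function which is `Γ`-varying at `0` with auxiliary function `ρ`,
where `ρ h = o(h)`. -/
structure MonotoneGammaVarying (G ρ : ℝ → ℝ) : Prop where
  mono : Monotone G
  nonneg : ∀ r, 0 ≤ G r
  aux_pos : ∀ᶠ h in 𝓝[>] (0 : ℝ), 0 < ρ h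
  aux_small : Tendsto (fun h => ρ h / h) (𝓝[>] 0) (𝓝 0)
  tendsto : ∀ x : ℝ,
    Tendsto (fun h => G (h + ρ h * x) / G h) (𝓝[>] 0) (𝓝 (Real.exp x))

theorem tendsto_shift_div {ρ : ℝ → ℝ} (hρ : Tendsto (fun h => ρ h / h) (𝓝[>] 0) (𝓝 0)) (x : ℝ) :
    Tendsto (fun h => (h + ρ h * x) / h) (𝓝[>] 0) (𝓝 1) := by
  have h1 : Tendsto (fun h => 1 + ρ h / h * x) (𝓝[>] 0) (𝓝 1) := by
    simpa using (hρ.mul_const x).const_add 1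
  refine h1.congr' ?_
  filter_upwards [self_mem_nhdsWithin] with h hh
  have : h ≠ 0 := ne_of_gt hh
  field_simp

theorem tendsto_shift {ρ : ℝ → ℝ} (hρ : Tendsto (fun h => ρ h / h) (𝓝[>] 0) (𝓝 0)) (x : ℝ) :
    Tendsto (fun h => h + ρ h * x) (𝓝[>] 0) (𝓝[>] 0) := by
  have h1 := tendsto_shift_div hρ x
  have h0 : Tendsto (fun h : ℝ => h) (𝓝[>] 0) (𝓝 0) := tendsto_nhdsWithin_of_tendsto_nhds tendsto_id
  refine tendsto_nhdsWithin_iff.2 ⟨?_, ?_⟩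
  · have h2 := h1.mul h0
    rw [mul_zero] at h2
    refine h2.congr' ?_
    filter_upwards [self_mem_nhdsWithin] with h hh
    have : h ≠ 0 := ne_of_gt hh
    field_simp
  · filter_upwards [self_mem_nhdsWithin, h1.eventually_const_lt zero_lt_one] with h hh h2
    exact (div_pos_iff_of_pos_right (Set.mem_Ioi.1 hh)).1 h2

namespace MonotoneGammaVarying

variable {G ρ : ℝ → ℝ}

theorem eventually_pos (hG : MonotoneGammaVarying G ρ) : ∀ᶠ h in 𝓝[>] (0 : ℝ), 0 < G h := by
  filter_upwards [(hG.tendsto 0).eventually_const_lt (Real.exp_pos 0)] with h hh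
  refine lt_of_le_of_ne (hG.nonneg h) fun h0 => ?_
  simp [← h0] at hh

/-- Moving by `ρ(h) x` and then by `ρ` at the new point multiplies `G` by `exp (x + 1)` in the
limit. If `ρ` at the new point were at most `a ρ(h)` with `a < 1`, monotonicity would allow only the
factor `exp (x + a)`. The case `a > 1` is symmetric. -/
theorem self_neglecting (hG : MonotoneGammaVarying G ρ) (x : ℝ) :
    Tendsto (fun h => ρ (h + ρ h * x) / ρ h) (𝓝[>] 0) (𝓝 1) := by
  have hs := tendsto_shift hG.aux_small x
  have h1 : Tendsto (fun h => G (h + ρ h * x + ρ (h + ρ h * x) * 1) / G h) (𝓝[>] 0)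
      (𝓝 (Real.exp (x + 1))) := by
    have := ((hG.tendsto 1).comp hs).mul (hG.tendsto x)
    rw [← Real.exp_add, add_comm 1 x] at this
    refine this.congr' ?_
    filter_upwards [hG.eventually_pos, hs.eventually hG.eventually_pos] with h h1 h2
    simp only [Function.comp_apply]
    field_simp
  rw [tendsto_order]
  constructor
  · intro a ha
    have h2 := hG.tendsto (x + a)
    have h3 : Real.exp (x + a) < Real.exp (x + 1) := Real.exp_lt_exp.2 (by linarith)
    filter_upwards [h2.eventually_lt h1 h3, hG.eventually_pos, hG.aux_pos] with h h4 h5 h6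
    rw [div_lt_div_iff_of_pos_right h5] at h4
    have := hG.mono.reflect_lt h4
    rw [lt_div_iff₀ h6]
    linarith
  · intro a ha
    have h2 := hG.tendsto (x + a)
    have h3 : Real.exp (x + 1) < Real.exp (x + a) := Real.exp_lt_exp.2 (by linarith)
    filter_upwards [h1.eventually_lt h2 h3, hG.eventually_pos, hG.aux_pos] with h h4 h5 h6
    rw [div_lt_div_iff_of_pos_right h5] at h4
    have := hG.mono.reflect_lt h4
    rw [div_lt_iff₀ h6]
    linarith

theorem tendsto_mul_aux (hG : MonotoneGammaVarying G ρ) (x : ℝ) :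
    Tendsto (fun h => ρ (h + ρ h * x) * G (h + ρ h * x) / (ρ h * G h)) (𝓝[>] 0)
      (𝓝 (Real.exp x)) := by
  have := (hG.self_neglecting x).mul (hG.tendsto x)
  rw [one_mul] at this
  refine this.congr fun h => ?_
  rw [div_mul_div_comm]

/-- Since `exp (-1) < 1/2`, a step of length `ρ` to the left eventually at least halves both `G` and
`ρ G`, so the integral is dominated by a geometric series. This crude bound controls the tail in the
sharp asymptotics. -/
theorem integral_le (hG : MonotoneGammaVarying G ρ) :
    ∀ᶠ h in 𝓝[>] (0 : ℝ), ∫ t in (0 : ℝ)..h, G t ≤ 2 * (ρ h * G h) := by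
  have he : Real.exp (-1) < 1 / 2 := by
    have := Real.exp_neg_one_lt_d9
    norm_num at this ⊢
    linarith
  have ev : ∀ᶠ h in 𝓝[>] (0 : ℝ), 0 < ρ h ∧ 0 < G h ∧ 0 < h + ρ h * (-1) ∧
      G (h + ρ h * (-1)) ≤ 1 / 2 * G h ∧
      ρ (h + ρ h * (-1)) * G (h + ρ h * (-1)) ≤ 1 / 2 * (ρ h * G h) := by
    filter_upwards [hG.aux_pos, hG.eventually_pos,
      (tendsto_shift hG.aux_small (-1)).eventually self_mem_nhdsWithin,
      (hG.tendsto (-1)).eventually_lt_const he,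
      (hG.tendsto_mul_aux (-1)).eventually_lt_const he] with h h1 h2 h3 h4 h5
    refine ⟨h1, h2, h3, ?_, ?_⟩
    · rw [div_lt_iff₀ h2] at h4
      exact h4.le
    · rw [div_lt_iff₀ (mul_pos h1 h2)] at h5
      exact h5.le
  obtain ⟨r₀, hr₀, hr⟩ := mem_nhdsGT_iff_exists_Ioo_subset.1 ev
  have hint : ∀ a b, IntervalIntegrable G volume a b := fun a b => hG.mono.intervalIntegrable
  -- Induction on the number `n` of halvings between `G r` and `G a`. The part of the integral left
  -- of `r - ρ r` is at most `2 · (1/2) ρ G`, and the last piece is at most `ρ G`. The lower end `a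
  -- > 0` keeps `G a` positive, so that some `n` exists; it is sent to `0` at the end.
  have step : ∀ a ∈ Set.Ioo 0 r₀, ∀ n : ℕ, ∀ r ∈ Set.Ioo 0 r₀, a ≤ r → G r ≤ 2 ^ n * G a →
      ∫ t in a..r, G t ≤ 2 * (ρ r * G r) := by
    intro a ha n
    have last : ∀ b ≤ a, ∀ r ∈ Set.Ioo 0 r₀, a ≤ r → r - b ≤ ρ r →
        ∫ t in a..r, G t ≤ 1 * (ρ r * G r) := by
      intro b hb r hr' har hbr
      have h2 : ∫ t in a..r, G t ≤ ∫ t in a..r, G r :=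
        intervalIntegral.integral_mono_on har (hint _ _) (by simp) fun t ht => hG.mono ht.2
      rw [intervalIntegral.integral_const, smul_eq_mul] at h2
      have := hG.nonneg r
      have : (r - a) * G r ≤ ρ r * G r := mul_le_mul_of_nonneg_right (by linarith) this
      linarith
    induction n with
    | zero =>
      intro r hr' har hn
      obtain ⟨h1, h2, h3, h4, h5⟩ := hr hr'
      -- With `G r ≤ G a`, a full step that stayed right of `a` would give `G a ≤ G r / 2 ≤ G a /
      -- 2`.
      have h6 : r + ρ r * (-1) ≤ a := by
        by_contra! hc
        have := hG.mono hc.le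
        have := (hr ha).2.1
        simp only [pow_zero, one_mul] at hn
        linarith
      have := last _ h6 r hr' har (by linarith)
      have := mul_pos h1 h2
      linarith
    | succ n ih =>
      intro r hr' har hn
      obtain ⟨h1, h2, h3, h4, h5⟩ := hr hr'
      have h7 := mul_pos h1 h2
      by_cases h6 : r + ρ r * (-1) ≤ a
      · have := last _ h6 r hr' har (by linarith)
        linarith
      · push Not at h6
        have h8 : r + ρ r * (-1) ∈ Set.Ioo 0 r₀ := ⟨h3, by linarith [hr'.2]⟩
        have h9 := ih _ h8 h6.le (by rw [pow_succ] at hn; linarith)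
        have h10 : ∫ t in (r + ρ r * (-1))..r, G t ≤ ∫ t in (r + ρ r * (-1))..r, G r :=
          intervalIntegral.integral_mono_on (by linarith) (hint _ _) (by simp)
            fun t ht => hG.mono ht.2
        rw [intervalIntegral.integral_const, smul_eq_mul] at h10
        rw [← intervalIntegral.integral_add_adjacent_intervals (hint a _) (hint _ r)]
        linarith
  filter_upwards [Ioo_mem_nhdsGT hr₀] with r hr'
  have hlim : Tendsto (fun a => ∫ t in a..r, G t) (𝓝[>] 0) (𝓝 (∫ t in (0 : ℝ)..r, G t)) := by
    have hc : Continuous fun a => ∫ t in r..a, G t :=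
      intervalIntegral.continuous_primitive (fun a b => hint a b) r
    have h1 := (hc.tendsto 0).neg
    simp only [← intervalIntegral.integral_symm] at h1
    exact tendsto_nhdsWithin_of_tendsto_nhds h1
  refine le_of_tendsto hlim ?_
  filter_upwards [Ioo_mem_nhdsGT hr'.1] with a ha
  have ha' : a ∈ Set.Ioo 0 r₀ := ⟨ha.1, ha.2.trans hr'.2⟩
  have hGa := (hr ha').2.1
  obtain ⟨n, hn⟩ := pow_unbounded_of_one_lt (G r / G a) (one_lt_two)
  exact step a ha' n r hr' ha.2.le (by rw [div_lt_iff₀ hGa] at hn; exact hn.le)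

/-- Substitute `t = h + ρ(h) x`. The integrand converges to `exp x` on `[-M, 0]` and is at most `1`
there by monotonicity, so dominated convergence applies. -/
theorem tendsto_integral_window (hG : MonotoneGammaVarying G ρ) {M : ℝ} (hM : 0 ≤ M) :
    Tendsto (fun h => (∫ t in (h + ρ h * (-M))..h, G t) / (ρ h * G h)) (𝓝[>] 0)
      (𝓝 (1 - Real.exp (-M))) := by
  have h1 : Tendsto (fun h => ∫ x in (-M)..0, G (h + ρ h * x) / G h) (𝓝[>] 0)
      (𝓝 (∫ x in (-M)..0, Real.exp x)) := by
    refine intervalIntegral.tendsto_integral_filter_of_dominated_convergence (fun _ => 1)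
      ?_ ?_ (by simp) ?_
    · filter_upwards [hG.aux_pos] with h hh
      have hm : Measurable fun x => G (h + ρ h * x) / G h :=
        (hG.mono.measurable.comp (by fun_prop)).div_const _
      exact hm.aestronglyMeasurable
    · filter_upwards [hG.aux_pos, hG.eventually_pos] with h h1 h2
      refine Eventually.of_forall fun x hx => ?_
      rw [Set.uIoc_of_le (by linarith)] at hx
      rw [Real.norm_of_nonneg (div_nonneg (hG.nonneg _) h2.le), div_le_one h2]
      refine hG.mono ?_
      have := mul_nonpos_of_nonneg_of_nonpos h1.le hx.2
      linarith
    · exact Eventually.of_forall fun x _ => hG.tendsto x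
  rw [integral_exp, Real.exp_zero] at h1
  refine h1.congr' ?_
  filter_upwards [hG.aux_pos, hG.eventually_pos] with h h2 h3
  rw [intervalIntegral.integral_div, intervalIntegral.integral_comp_add_mul _ h2.ne']
  simp only [mul_zero, add_zero, smul_eq_mul]
  field_simp

/-- The primitive of a monotone `Γ`-varying function is asymptotic to `ρ G`. -/
theorem tendsto_integral_div (hG : MonotoneGammaVarying G ρ) :
    Tendsto (fun h => (∫ t in (0 : ℝ)..h, G t) / (ρ h * G h)) (𝓝[>] 0) (𝓝 1) := by
  have hint : ∀ a b, IntervalIntegrable G volume a b := fun a b => hG.mono.intervalIntegrable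
  have hsplit : ∀ M : ℝ, ∀ h, (∫ t in (0 : ℝ)..h, G t) / (ρ h * G h) =
      (∫ t in (0 : ℝ)..(h + ρ h * (-M)), G t) / (ρ h * G h) +
      (∫ t in (h + ρ h * (-M))..h, G t) / (ρ h * G h) := by
    intro M h
    rw [← add_div, intervalIntegral.integral_add_adjacent_intervals (hint _ _) (hint _ _)]
  have hexp : Tendsto (fun M : ℝ => Real.exp (-M)) atTop (𝓝 0) :=
    Real.tendsto_exp_neg_atTop_nhds_zero
  rw [tendsto_order]
  constructor
  · intro a ha
    obtain ⟨M, hM, hM0⟩ := ((hexp.eventually_lt_const (show (0 : ℝ) < 1 - a by linarith)).and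
      (eventually_ge_atTop 0)).exists
    filter_upwards [(hG.tendsto_integral_window hM0).eventually_const_lt
      (show a < 1 - Real.exp (-M) by linarith), hG.aux_pos, hG.eventually_pos,
      (tendsto_shift hG.aux_small (-M)).eventually self_mem_nhdsWithin] with h h1 h2 h3 h4
    rw [hsplit M h]
    have : 0 ≤ (∫ t in (0 : ℝ)..(h + ρ h * (-M)), G t) / (ρ h * G h) :=
      div_nonneg (intervalIntegral.integral_nonneg (le_of_lt h4) fun t _ => hG.nonneg t)
        (mul_pos h2 h3).le
    linarith
  · intro a ha
    obtain ⟨M, hM, hM0⟩ := ((hexp.eventually_lt_const (show (0 : ℝ) < a - 1 by linarith)).and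
      (eventually_ge_atTop 0)).exists
    -- The crude bound on the tail tends to `2 exp (-M)`. Together with the window the total is `1 +
    -- exp (-M)`, which is below `a` by the choice of `M`.
    have hl := ((hG.tendsto_mul_aux (-M)).const_mul 2).add (hG.tendsto_integral_window hM0)
    filter_upwards [hl.eventually_lt_const
      (show 2 * Real.exp (-M) + (1 - Real.exp (-M)) < a by linarith), hG.aux_pos,
      hG.eventually_pos,
      (tendsto_shift hG.aux_small (-M)).eventually hG.integral_le] with h h1 h2 h3 h4
    rw [hsplit M h]
    have := div_le_div_of_nonneg_right h4 (mul_pos h2 h3).le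
    rw [mul_div_assoc] at this
    linarith

/-- The primitive is equivalent to `ρ G`, whose ratios have the same limit as those of `G` because
`ρ` is self-neglecting. -/
theorem primitive (hG : MonotoneGammaVarying G ρ) (h0 : ∀ r ≤ 0, G r = 0) :
    MonotoneGammaVarying (fun r => ∫ t in (0 : ℝ)..r, G t) ρ where
  mono := by
    have hint : ∀ a b, IntervalIntegrable G volume a b := fun a b => hG.mono.intervalIntegrable
    intro a b hab
    have := intervalIntegral.integral_interval_sub_left (hint 0 b) (hint 0 a)
    have h1 : 0 ≤ ∫ t in a..b, G t := intervalIntegral.integral_nonneg hab fun t _ => hG.nonneg t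
    simp only
    linarith
  nonneg := by
    intro r
    rcases le_total 0 r with hr | hr
    · exact intervalIntegral.integral_nonneg hr fun t _ => hG.nonneg t
    · refine le_of_eq ?_
      rw [intervalIntegral.integral_congr (g := fun _ => (0 : ℝ))]
      · simp
      · intro t ht
        rw [Set.uIcc_of_ge hr] at ht
        exact h0 t ht.2
  aux_pos := hG.aux_pos
  aux_small := hG.aux_small
  tendsto := by
    intro x
    have hA := hG.tendsto_integral_div
    have hs := tendsto_shift hG.aux_small x
    have := ((hA.comp hs).mul (hG.tendsto_mul_aux x)).div hA one_ne_zero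
    rw [one_mul, div_one] at this
    refine this.congr' ?_
    filter_upwards [hG.aux_pos, hG.eventually_pos, hs.eventually hG.aux_pos,
      hs.eventually hG.eventually_pos] with h h1 h2 h3 h4
    simp only [Function.comp_apply, Pi.div_apply]
    field_simp

theorem max_mul (hG : MonotoneGammaVarying G ρ) :
    MonotoneGammaVarying (fun r => max r 0 * G r) ρ where
  mono := fun a b hab => mul_le_mul (max_le_max_right 0 hab) (hG.mono hab) (hG.nonneg a)
    (le_max_right _ _)
  nonneg := fun r => mul_nonneg (le_max_right _ _) (hG.nonneg r)
  aux_pos := hG.aux_pos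
  aux_small := hG.aux_small
  tendsto := by
    intro x
    have := (tendsto_shift_div hG.aux_small x).mul (hG.tendsto x)
    rw [one_mul] at this
    refine this.congr' ?_
    filter_upwards [self_mem_nhdsWithin,
      (tendsto_shift hG.aux_small x).eventually self_mem_nhdsWithin] with h h1 h2
    rw [max_eq_left (le_of_lt h2), max_eq_left (le_of_lt h1), div_mul_div_comm]

end MonotoneGammaVarying

/-! ### From an almost-everywhere comparison to a monotone Γ-varying function -/

/-- Allows a property of almost every real to be used at `a + b x` for almost every `x`. -/
theorem quasiMeasurePreserving_affine (a : ℝ) {b : ℝ} (hb : b ≠ 0) :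
    Measure.QuasiMeasurePreserving (fun x : ℝ => a + b * x) volume volume := by
  have h1 : Measure.QuasiMeasurePreserving (fun x : ℝ => b * x) volume volume := by
    refine ⟨by fun_prop, ?_⟩
    rw [Real.map_volume_mul_left hb]
    exact Measure.smul_absolutelyContinuous
  exact (measurePreserving_add_left volume a).quasiMeasurePreserving.comp h1

/-- If `G` and `g` are asymptotic almost everywhere at `0`, where `g` is `Γ`-varying and `G` is
monotone and vanishes on the nonpositive reals, then the auxiliary function is `o(h)`. -/
theorem LocalPCA.IsGammaVaryingAtZero.aux_small {g G ρ : ℝ → ℝ}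
    (hg : LocalPCA.IsGammaVaryingAtZero g ρ) (h0 : ∀ r ≤ 0, G r = 0)
    (hgG : ∀ ε > 0, ∃ δ > 0, ∀ᵐ r, r < δ → |g r - G r| ≤ ε * G r) :
    Tendsto (fun h => ρ h / h) (𝓝[>] 0) (𝓝 0) := by
  have hneg : ∀ᵐ r, r < 0 → g r = 0 := by
    obtain ⟨δ, hδ, h⟩ := hgG 1 one_pos
    filter_upwards [h] with r hr hr0
    have := hr (hr0.trans hδ)
    rw [h0 r hr0.le] at this
    simpa using this
  rw [tendsto_order]
  constructor
  · intro a ha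
    filter_upwards [hg.aux_pos, self_mem_nhdsWithin] with h h1 h2
    exact ha.trans (div_pos h1 h2)
  · intro c hc
    by_contra hcon
    rw [not_eventually] at hcon
    have hfr : ∃ᶠ h in 𝓝[>] (0 : ℝ), c ≤ ρ h / h := hcon.mono fun h => not_lt.1
    -- Along a sequence only countably many null sets must be avoided, so one `x < -1/c` works for
    -- every term. All the points `u n + ρ (u n) x` are then negative, `g` vanishes there, and the
    -- limit of the ratios would be `0` instead of `exp x`.
    obtain ⟨u, hu, hu'⟩ := exists_seq_forall_of_frequently
      (hfr.and_eventually (hg.aux_pos.and self_mem_nhdsWithin))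
    have hae : ∀ᵐ x : ℝ, ∀ n, u n + ρ (u n) * x < 0 → g (u n + ρ (u n) * x) = 0 := by
      rw [ae_all_iff]
      intro n
      exact (quasiMeasurePreserving_affine _ (hu' n).2.1.ne').ae hneg
    obtain ⟨x, hx, hxc⟩ : ∃ x : ℝ, (∀ n, u n + ρ (u n) * x < 0 → g (u n + ρ (u n) * x) = 0) ∧
        x < -(1 / c) := by
      have : (ae (volume.restrict (Set.Iio (-(1 / c))))).NeBot := by
        rw [ae_neBot]
        intro h
        have := congrArg (fun μ => μ Set.univ) h
        simp at this
      exact ((ae_restrict_of_ae hae).and (ae_restrict_mem measurableSet_Iio)).exists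
    have hlim := (hg.tendsto x).comp hu
    have hz : ∀ n, g (u n + ρ (u n) * x) / g (u n) = 0 := by
      intro n
      obtain ⟨h1, h2, h3⟩ := hu' n
      have h3 : 0 < u n := h3
      rw [hx n, zero_div]
      have h4 : c * u n ≤ ρ (u n) := by rwa [le_div_iff₀ h3] at h1
      have h5 : ρ (u n) * x < ρ (u n) * (-(1 / c)) := mul_lt_mul_of_pos_left hxc h2
      have h6 : u n ≤ ρ (u n) * (1 / c) := by
        rw [mul_one_div, le_div_iff₀ hc]
        linarith
      linarith
    have hlim' : Tendsto (fun _ : ℕ => (0 : ℝ)) atTop (𝓝 (Real.exp x)) :=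
      hlim.congr fun n => by simpa using hz n
    have := tendsto_nhds_unique hlim' tendsto_const_nhds
    exact (Real.exp_pos x).ne' this

/-- The comparison of `g` with `G` fails on a null set that may contain the points `h + ρ(h) x`.
Along a fixed sequence `h = u n` it holds for almost every `x`, hence for a dense set of `x`;
monotonicity of `G` and continuity of `exp` then give every `x`. The denominator stays `g h`, so `x
= 0` yields a genuine pointwise equivalence of `G` and `g`. -/
theorem LocalPCA.IsGammaVaryingAtZero.tendsto_div_of_monotone {g G ρ : ℝ → ℝ}
    (hg : LocalPCA.IsGammaVaryingAtZero g ρ) (hgn : ∀ t, 0 ≤ g t) (hG : Monotone G)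
    (h0 : ∀ r ≤ 0, G r = 0)
    (hgG : ∀ ε > 0, ∃ δ > 0, ∀ᵐ r, r < δ → |g r - G r| ≤ ε * G r) (x : ℝ) :
    Tendsto (fun h => G (h + ρ h * x) / g h) (𝓝[>] 0) (𝓝 (Real.exp x)) := by
  have hsmall := hg.aux_small h0 hgG
  choose δ hδ hgG using fun k : ℕ => hgG (1 / ((k : ℝ) + 1)) (by positivity)
  have hk : Tendsto (fun k : ℕ => 1 / ((k : ℝ) + 1)) atTop (𝓝 0) :=
    tendsto_one_div_add_atTop_nhds_zero_nat
  refine tendsto_of_seq_tendsto fun u hu => ?_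
  have hae : ∀ᵐ y : ℝ, ∀ n, ρ (u n) ≠ 0 → ∀ k, u n + ρ (u n) * y < δ k →
      |g (u n + ρ (u n) * y) - G (u n + ρ (u n) * y)| ≤
        1 / ((k : ℝ) + 1) * G (u n + ρ (u n) * y) := by
    rw [ae_all_iff]
    intro n
    by_cases hn : ρ (u n) = 0
    · simp [hn]
    · simpa [hn] using (quasiMeasurePreserving_affine (u n) hn).ae (ae_all_iff.2 hgG)
  have hdense := Measure.dense_of_ae hae
  have hgood : ∀ y, (∀ n, ρ (u n) ≠ 0 → ∀ k, u n + ρ (u n) * y < δ k →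
      |g (u n + ρ (u n) * y) - G (u n + ρ (u n) * y)| ≤
        1 / ((k : ℝ) + 1) * G (u n + ρ (u n) * y)) →
      Tendsto (fun n => G (u n + ρ (u n) * y) / g (u n)) atTop (𝓝 (Real.exp y)) := by
    intro y hy
    have ha : Tendsto (fun n => g (u n + ρ (u n) * y) / g (u n)) atTop (𝓝 (Real.exp y)) :=
      (hg.tendsto y).comp hu
    have hb : ∀ k : ℕ, ∀ᶠ n in atTop,
        |g (u n + ρ (u n) * y) / g (u n) - G (u n + ρ (u n) * y) / g (u n)| ≤
          1 / ((k : ℝ) + 1) * (G (u n + ρ (u n) * y) / g (u n)) := by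
      intro k
      have h1 : Tendsto (fun n => u n + ρ (u n) * y) atTop (𝓝 0) :=
        tendsto_nhds_of_tendsto_nhdsWithin ((tendsto_shift hsmall y).comp hu)
      filter_upwards [h1.eventually_lt_const (hδ k), hu.eventually hg.aux_pos] with n h2 h3
      rw [← sub_div, abs_div, abs_of_nonneg (hgn (u n)), ← mul_div_assoc]
      exact div_le_div_of_nonneg_right (hy n h3.ne' k h2) (hgn _)
    rw [tendsto_order]
    constructor
    · intro c hc
      have h2 : Tendsto (fun k : ℕ => c * (1 + 1 / ((k : ℝ) + 1))) atTop (𝓝 c) := by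
        simpa using (hk.const_add 1).const_mul c
      obtain ⟨k, hk'⟩ := (h2.eventually_lt_const hc).exists
      filter_upwards [ha.eventually_const_lt hk', hb k] with n h3 h4
      have h5 : 0 < 1 + 1 / ((k : ℝ) + 1) := by positivity
      have h6 := (abs_le.1 h4).2
      refine lt_of_mul_lt_mul_right ?_ h5.le
      linarith
    · intro c hc
      have h2 : Tendsto (fun k : ℕ => c * (1 - 1 / ((k : ℝ) + 1))) atTop (𝓝 c) := by
        simpa using (hk.const_sub 1).const_mul c
      obtain ⟨k, hk', hk1⟩ := ((h2.eventually_const_lt hc).and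
        (hk.eventually_lt_const one_pos)).exists
      filter_upwards [ha.eventually_lt_const hk', hb k] with n h3 h4
      have h6 := (abs_le.1 h4).1
      refine lt_of_mul_lt_mul_right (a := 1 - 1 / ((k : ℝ) + 1)) ?_ (by linarith)
      linarith
  -- An arbitrary `x` is now squeezed by good points `y` on either side, with `exp y` still on the
  -- right side of `c`.
  rw [tendsto_order]
  constructor
  · intro c hc
    obtain ⟨z, hz1, hz2⟩ : ∃ z < x, c < Real.exp z := by
      have := (Real.continuous_exp.tendsto x).mono_left (nhdsWithin_le_nhds (s := Set.Iio x))
      obtain ⟨z, h1, h2⟩ := ((this.eventually_const_lt hc).and self_mem_nhdsWithin).exists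
      exact ⟨z, h2, h1⟩
    obtain ⟨y, hy, hy1, hy2⟩ := hdense.exists_between hz1
    filter_upwards [(hgood y hy).eventually_const_lt (hz2.trans (Real.exp_lt_exp.2 hy1)),
      hu.eventually hg.aux_pos] with n h1 h2
    refine h1.trans_le (div_le_div_of_nonneg_right (hG ?_) (hgn _))
    have := mul_lt_mul_of_pos_left hy2 h2
    linarith
  · intro c hc
    obtain ⟨z, hz1, hz2⟩ : ∃ z > x, Real.exp z < c := by
      have := (Real.continuous_exp.tendsto x).mono_left (nhdsWithin_le_nhds (s := Set.Ioi x))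
      obtain ⟨z, h1, h2⟩ := ((this.eventually_lt_const hc).and self_mem_nhdsWithin).exists
      exact ⟨z, h2, h1⟩
    obtain ⟨y, hy, hy1, hy2⟩ := hdense.exists_between hz1
    filter_upwards [(hgood y hy).eventually_lt_const ((Real.exp_lt_exp.2 hy2).trans hz2),
      hu.eventually hg.aux_pos] with n h1 h2
    refine (div_le_div_of_nonneg_right (hG ?_) (hgn _)).trans_lt h1
    have := mul_lt_mul_of_pos_left hy1 h2
    linarith

section Transfer

variable {g G ρ : ℝ → ℝ}

theorem LocalPCA.IsGammaVaryingAtZero.tendsto_div_self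
    (hg : LocalPCA.IsGammaVaryingAtZero g ρ) (hgn : ∀ t, 0 ≤ g t) (hG : Monotone G)
    (h0 : ∀ r ≤ 0, G r = 0)
    (hgG : ∀ ε > 0, ∃ δ > 0, ∀ᵐ r, r < δ → |g r - G r| ≤ ε * G r) :
    Tendsto (fun h => G h / g h) (𝓝[>] 0) (𝓝 1) := by
  simpa using hg.tendsto_div_of_monotone hgn hG h0 hgG 0

theorem LocalPCA.IsGammaVaryingAtZero.monotoneGammaVarying
    (hg : LocalPCA.IsGammaVaryingAtZero g ρ) (hgn : ∀ t, 0 ≤ g t) (hG : Monotone G)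
    (h0 : ∀ r ≤ 0, G r = 0)
    (hgG : ∀ ε > 0, ∃ δ > 0, ∀ᵐ r, r < δ → |g r - G r| ≤ ε * G r) :
    MonotoneGammaVarying G ρ where
  mono := hG
  nonneg := fun r => by
    rcases le_total 0 r with hr | hr
    · exact (h0 0 le_rfl) ▸ hG hr
    · exact (h0 r hr).ge
  aux_pos := hg.aux_pos
  aux_small := hg.aux_small h0 hgG
  tendsto := fun x => by
    have h1 := hg.tendsto_div_self hgn hG h0 hgG
    have := (hg.tendsto_div_of_monotone hgn hG h0 hgG x).div h1 one_ne_zero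
    rw [div_one] at this
    refine this.congr' ?_
    filter_upwards [h1.eventually_const_lt one_pos] with h h2
    have h3 : g h ≠ 0 := fun h3 => by simp [h3] at h2
    simp only [Pi.div_apply]
    rw [div_div_div_cancel_right₀ h3]

/-- `r ∫₀ʳ G` is asymptotic to `r ρ(r) g(r)`. -/
theorem LocalPCA.IsGammaVaryingAtZero.isEquivalent_primitive
    (hg : LocalPCA.IsGammaVaryingAtZero g ρ) (hgn : ∀ t, 0 ≤ g t) (hG : Monotone G)
    (h0 : ∀ r ≤ 0, G r = 0)
    (hgG : ∀ ε > 0, ∃ δ > 0, ∀ᵐ r, r < δ → |g r - G r| ≤ ε * G r) :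
    (fun r => max r 0 * ∫ t in (0 : ℝ)..r, G t) ~[𝓝[>] 0] fun r => r * ρ r * g r := by
  have hM := hg.monotoneGammaVarying hgn hG h0 hgG
  have h1 := hg.tendsto_div_self hgn hG h0 hgG
  have h2 := hM.tendsto_integral_div.mul h1
  rw [one_mul] at h2
  refine isEquivalent_of_tendsto_one (h2.congr' ?_)
  filter_upwards [h1.eventually_const_lt one_pos, self_mem_nhdsWithin, hM.eventually_pos,
    hM.aux_pos] with h h3 h4 h5 h6
  have h7 : g h ≠ 0 := fun h7 => by simp [h7] at h3
  have h4 : 0 < h := h4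
  simp only [Pi.div_apply, max_eq_left h4.le]
  field_simp

/-- `r ∫₀ʳ t ∫₀ᵗ G` is asymptotic to `r² ρ(r)² g(r)`. -/
theorem LocalPCA.IsGammaVaryingAtZero.isEquivalent_primitive_primitive
    (hg : LocalPCA.IsGammaVaryingAtZero g ρ) (hgn : ∀ t, 0 ≤ g t) (hG : Monotone G)
    (h0 : ∀ r ≤ 0, G r = 0)
    (hgG : ∀ ε > 0, ∃ δ > 0, ∀ᵐ r, r < δ → |g r - G r| ≤ ε * G r) :
    (fun r => max r 0 * ∫ t in (0 : ℝ)..r, max t 0 * ∫ s in (0 : ℝ)..t, G s) ~[𝓝[>] 0]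
      fun r => r ^ 2 * ρ r ^ 2 * g r := by
  have hM := hg.monotoneGammaVarying hgn hG h0 hgG
  -- The function `t ∫₀ᵗ G` is again monotone `Γ`-varying with the same `ρ`, so the asymptotics of
  -- primitives apply a second time.
  have hM' := (hM.primitive h0).max_mul
  have h1 := hg.isEquivalent_primitive hgn hG h0 hgG
  have h2 : (fun r => max r 0 * ∫ t in (0 : ℝ)..r, max t 0 * ∫ s in (0 : ℝ)..t, G s) ~[𝓝[>] 0]
      fun r => r * ρ r * (max r 0 * ∫ t in (0 : ℝ)..r, G t) := by
    refine isEquivalent_of_tendsto_one (hM'.tendsto_integral_div.congr' ?_)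
    filter_upwards [self_mem_nhdsWithin, hM'.eventually_pos, hM.aux_pos] with h h4 h5 h6
    have h4 : 0 < h := h4
    simp only [Pi.div_apply]
    rw [max_eq_left h4.le] at h5 ⊢
    field_simp
  refine h2.trans ?_
  have h3 := (IsEquivalent.refl (u := fun r => r * ρ r) (l := 𝓝[>] (0 : ℝ))).mul h1
  refine h3.congr_right (Eventually.of_forall fun r => ?_)
  simp only [Pi.mul_apply]
  ring

end Transfer

/-! ### Radial integrals: angular and truncated moments -/

/-- The angular moment `∫ cos^(2a) sin^(2b)` over the circle. -/
noncomputable def angularMoment (a b : ℕ) : ℝ :=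
  ∫ θ in (-Real.pi)..Real.pi, Real.cos θ ^ (2 * a) * Real.sin θ ^ (2 * b)

theorem angularMoment_zero_zero : angularMoment 0 0 = 2 * Real.pi := by
  simp [angularMoment, two_mul]

theorem angularMoment_one_zero : angularMoment 1 0 = Real.pi := by
  simp [angularMoment, integral_cos_sq]

theorem angularMoment_one_one : angularMoment 1 1 = Real.pi / 4 := by
  have h1 : Real.sin (4 * Real.pi) = 0 := by
    have := Real.sin_nat_mul_pi 4
    exact_mod_cast this
  have h2 : Real.sin (4 * -Real.pi) = 0 := by
    rw [mul_neg, Real.sin_neg, h1, neg_zero]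
  have : angularMoment 1 1 =
      ∫ θ in (-Real.pi)..Real.pi, Real.sin θ ^ 2 * Real.cos θ ^ 2 := by
    simp [angularMoment, mul_comm]
  rw [this, integral_sin_sq_mul_cos_sq, h1, h2]
  ring

/-- Polar coordinates; the exponent `2 (a + b) + 1` includes the Jacobian `u`. -/
theorem lintegral_plane_radial {φ : ℝ → ENNReal} (hφ : Measurable φ) (s : ℝ) (a b : ℕ) :
    ∫⁻ x : ℝ × ℝ, φ (√(x.1 ^ 2 + x.2 ^ 2 + s)) * ENNReal.ofReal (x.1 ^ (2 * a) * x.2 ^ (2 * b)) =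
      ENNReal.ofReal (angularMoment a b) *
        ∫⁻ u in Set.Ioi (0 : ℝ), φ (√(u ^ 2 + s)) * ENNReal.ofReal (u ^ (2 * (a + b) + 1)) := by
  rw [← lintegral_comp_polarCoord_symm, polarCoord_target]
  have hθ : ENNReal.ofReal (angularMoment a b) = ∫⁻ θ in Set.Ioo (-Real.pi) Real.pi,
      ENNReal.ofReal (Real.cos θ ^ (2 * a) * Real.sin θ ^ (2 * b)) := by
    rw [angularMoment, intervalIntegral.integral_of_le (by linarith [Real.pi_pos]),
      integral_Ioc_eq_integral_Ioo, ofReal_integral_eq_lintegral_ofReal]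
    · have : Continuous fun θ => Real.cos θ ^ (2 * a) * Real.sin θ ^ (2 * b) := by fun_prop
      exact (this.integrableOn_Icc).mono_set Set.Ioo_subset_Icc_self
    · exact Eventually.of_forall fun θ => mul_nonneg ((even_two_mul a).pow_nonneg _)
        ((even_two_mul b).pow_nonneg _)
  have key : ∫⁻ p in Set.Ioi (0 : ℝ) ×ˢ Set.Ioo (-Real.pi) Real.pi,
      (φ (√(p.1 ^ 2 + s)) * ENNReal.ofReal (p.1 ^ (2 * (a + b) + 1))) *
        ENNReal.ofReal (Real.cos p.2 ^ (2 * a) * Real.sin p.2 ^ (2 * b)) =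
      (∫⁻ u in Set.Ioi (0 : ℝ), φ (√(u ^ 2 + s)) * ENNReal.ofReal (u ^ (2 * (a + b) + 1))) *
      ∫⁻ θ in Set.Ioo (-Real.pi) Real.pi,
        ENNReal.ofReal (Real.cos θ ^ (2 * a) * Real.sin θ ^ (2 * b)) := by
    rw [Measure.volume_eq_prod, ← Measure.prod_restrict]
    have hf : Measurable fun u : ℝ => φ (√(u ^ 2 + s)) *
        ENNReal.ofReal (u ^ (2 * (a + b) + 1)) := by fun_prop
    have hg : Measurable fun θ : ℝ =>
        ENNReal.ofReal (Real.cos θ ^ (2 * a) * Real.sin θ ^ (2 * b)) := by fun_prop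
    exact lintegral_prod_mul hf.aemeasurable hg.aemeasurable
  rw [hθ, mul_comm (lintegral _ _), ← key]
  refine setLIntegral_congr_fun (by measurability) fun p hp => ?_
  have hp0 : 0 < p.1 := hp.1
  have h1 : (p.1 * Real.cos p.2) ^ 2 + (p.1 * Real.sin p.2) ^ 2 = p.1 ^ 2 := by
    linear_combination p.1 ^ 2 * Real.sin_sq_add_cos_sq p.2
  simp only [polarCoord_symm_apply, h1, smul_eq_mul]
  rw [mul_left_comm, mul_assoc, ← ENNReal.ofReal_mul hp0.le, ← ENNReal.ofReal_mul (by positivity)]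
  congr 2
  ring

/-- Substitute `r = √(u² + s)`, so that `u du = r dr` and `u² = r² - s`. -/
theorem lintegral_shift_radius {φ : ℝ → ENNReal} {s : ℝ} (hs : 0 ≤ s) (k : ℕ) :
    ∫⁻ u in Set.Ioi (0 : ℝ), φ (√(u ^ 2 + s)) * ENNReal.ofReal (u ^ (2 * k + 1)) =
      ∫⁻ r in Set.Ioi (√s), φ r * ENNReal.ofReal (r * (r ^ 2 - s) ^ k) := by
  have himg : (fun u : ℝ => √(u ^ 2 + s)) '' Set.Ioi 0 = Set.Ioi (√s) := by
    ext r
    constructor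
    · rintro ⟨u, hu, rfl⟩
      have hu : 0 < u := hu
      exact Real.sqrt_lt_sqrt hs (by nlinarith)
    · intro hr
      have hr0 : 0 < r := (Real.sqrt_nonneg s).trans_lt hr
      have hr2 : s < r ^ 2 := (Real.sqrt_lt' hr0).1 hr
      refine ⟨√(r ^ 2 - s), Real.sqrt_pos.2 (by linarith), ?_⟩
      simp only
      rw [Real.sq_sqrt (by linarith), sub_add_cancel, Real.sqrt_sq hr0.le]
  rw [← himg, lintegral_image_eq_lintegral_abs_deriv_mul measurableSet_Ioi
    (f' := fun u => u / √(u ^ 2 + s))]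
  · refine setLIntegral_congr_fun measurableSet_Ioi fun u hu => ?_
    have hu : 0 < u := hu
    have h1 : 0 < u ^ 2 + s := by positivity
    have h2 : 0 < √(u ^ 2 + s) := Real.sqrt_pos.2 h1
    rw [Real.sq_sqrt h1.le, add_sub_cancel_right, abs_of_pos (by positivity), mul_left_comm,
      ← ENNReal.ofReal_mul (by positivity)]
    congr 2
    field_simp
    ring
  · intro u hu
    have hu : 0 < u := hu
    have h1 : 0 < u ^ 2 + s := by positivity
    have := ((hasDerivAt_pow 2 u).add_const s).sqrt h1.ne'
    refine (this.congr_deriv ?_).hasDerivWithinAt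
    have h2 : 0 < √(u ^ 2 + s) := Real.sqrt_pos.2 h1
    field_simp
    norm_num
  · intro u hu t ht hut
    have hu : 0 < u := hu
    have ht : 0 < t := ht
    have h := (Real.sqrt_inj (by positivity) (by positivity)).1 hut
    have h2 : u ^ 2 = t ^ 2 := by linarith
    exact (sq_eq_sq₀ hu.le ht.le).1 h2

/-- The truncated moment `∫ (r² - s)₊ᵏ ν(ds)`, over those `s` with `√s < r`. -/
noncomputable def truncMoment (ν : Measure ℝ) (k : ℕ) (r : ℝ) : ENNReal :=
  ∫⁻ s, (if √s < r then ENNReal.ofReal ((r ^ 2 - s) ^ k) else 0) ∂ν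

theorem measurable_truncMoment_integrand (k : ℕ) :
    Measurable fun x : ℝ × ℝ =>
      if √x.2 < x.1 then ENNReal.ofReal ((x.1 ^ 2 - x.2) ^ k) else 0 := by
  refine Measurable.ite ?_ (by fun_prop) measurable_const
  exact measurableSet_lt (by fun_prop) (by fun_prop)

theorem measurable_truncMoment (ν : Measure ℝ) [SFinite ν] (k : ℕ) :
    Measurable (truncMoment ν k) :=
  (measurable_truncMoment_integrand k).lintegral_prod_right'

theorem truncMoment_zero (ν : Measure ℝ) (r : ℝ) : truncMoment ν 0 r = ν {s | √s < r} := by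
  have h : MeasurableSet {s : ℝ | √s < r} := measurableSet_lt (by fun_prop) (by fun_prop)
  rw [← lintegral_indicator_one h]
  refine lintegral_congr fun s => ?_
  simp [Set.indicator_apply]

/-- The distance to the origin in the product of the plane and a squared radius. -/
noncomputable def coneRadius (x : (ℝ × ℝ) × ℝ) : ℝ := √(x.1.1 ^ 2 + x.1.2 ^ 2 + x.2)

theorem measurable_coneRadius : Measurable coneRadius := by
  unfold coneRadius
  fun_prop

theorem lintegral_cone_radial {ν : Measure ℝ} [SFinite ν] (hν : ∀ᵐ s ∂ν, 0 ≤ s)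
    {φ : ℝ → ENNReal} (hφ : Measurable φ) (a b : ℕ) :
    ∫⁻ x, φ (coneRadius x) * ENNReal.ofReal (x.1.1 ^ (2 * a) * x.1.2 ^ (2 * b))
        ∂((volume : Measure (ℝ × ℝ)).prod ν) =
      ∫⁻ r, φ r * (ENNReal.ofReal (angularMoment a b) *
        (ENNReal.ofReal r * truncMoment ν (a + b) r)) := by
  have hm := measurable_coneRadius
  rw [lintegral_prod_symm _ (by fun_prop)]
  have h1 : ∀ᵐ s ∂ν, ∫⁻ x : ℝ × ℝ, φ (coneRadius (x, s)) *
      ENNReal.ofReal (x.1 ^ (2 * a) * x.2 ^ (2 * b)) =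
      ∫⁻ r, φ r * ENNReal.ofReal (angularMoment a b) * (ENNReal.ofReal r *
        if √s < r then ENNReal.ofReal ((r ^ 2 - s) ^ (a + b)) else 0) := by
    filter_upwards [hν] with s hs
    simp only [coneRadius]
    rw [lintegral_plane_radial hφ s a b, lintegral_shift_radius hs,
      ← lintegral_const_mul _ (by fun_prop), ← lintegral_indicator measurableSet_Ioi]
    refine lintegral_congr fun r => ?_
    by_cases hr : √s < r
    · have hr0 : 0 ≤ r := (Real.sqrt_nonneg s).trans hr.le
      rw [Set.indicator_of_mem (Set.mem_Ioi.2 hr), if_pos hr, ENNReal.ofReal_mul hr0]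
      ring
    · rw [Set.indicator_of_notMem (by simpa using hr), if_neg hr]
      simp
  rw [lintegral_congr_ae h1, lintegral_lintegral_swap]
  · refine lintegral_congr fun r => ?_
    have hmr := (measurable_truncMoment_integrand (a + b)).comp (measurable_prodMk_left (x := r))
    simp only [Function.comp_def] at hmr
    rw [lintegral_const_mul _ (hmr.const_mul _), lintegral_const_mul _ hmr, mul_assoc]
    rfl
  · have h2 := (measurable_truncMoment_integrand (a + b)).comp (measurable_swap (α := ℝ) (β := ℝ))
    simp only [Function.comp_def, Prod.fst_swap, Prod.snd_swap] at h2
    refine Measurable.aemeasurable ?_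
    exact ((hφ.comp measurable_snd).mul_const _).mul
      ((ENNReal.measurable_ofReal.comp measurable_snd).mul h2)

theorem lintegral_pow_sub {s r : ℝ} (hs : 0 ≤ s) (hsr : √s < r) (k : ℕ) :
    ∫⁻ t in Set.Ioc (√s) r, ENNReal.ofReal (2 * (k + 1) * t * (t ^ 2 - s) ^ k) =
      ENNReal.ofReal ((r ^ 2 - s) ^ (k + 1)) := by
  have hpos : ∀ t ∈ Set.Ioc (√s) r, 0 ≤ 2 * (k + 1) * t * (t ^ 2 - s) ^ k := by
    intro t ht
    have ht0 : 0 < t := (Real.sqrt_nonneg s).trans_lt ht.1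
    have := (Real.sqrt_lt' ht0).1 ht.1
    have : 0 ≤ t ^ 2 - s := by linarith
    positivity
  have hc : Continuous fun t : ℝ => 2 * (k + 1) * t * (t ^ 2 - s) ^ k := by fun_prop
  rw [← ofReal_integral_eq_lintegral_ofReal
    (hc.integrableOn_Icc.mono_set Set.Ioc_subset_Icc_self)
    ((ae_restrict_mem measurableSet_Ioc).mono hpos),
    ← intervalIntegral.integral_of_le hsr.le]
  congr 1
  have hd : ∀ t ∈ Set.uIcc (√s) r,
      HasDerivAt (fun t : ℝ => (t ^ 2 - s) ^ (k + 1)) (2 * (k + 1) * t * (t ^ 2 - s) ^ k) t := by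
    intro t _
    have := ((hasDerivAt_pow 2 t).sub_const s).pow (k + 1)
    refine this.congr_deriv ?_
    push_cast
    ring
  rw [intervalIntegral.integral_eq_sub_of_hasDerivAt hd (hc.intervalIntegrable _ _),
    Real.sq_sqrt hs]
  simp

/-- For fixed `s`, `(r² - s)ᵏ⁺¹` is the integral of its derivative from `√s`, where it vanishes;
Tonelli does the rest. This recursion is what turns higher moments into iterated primitives of the
cone density. -/
theorem truncMoment_succ {ν : Measure ℝ} [SFinite ν] (hν : ∀ᵐ s ∂ν, 0 ≤ s) (k : ℕ) (r : ℝ) :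
    truncMoment ν (k + 1) r =
      ∫⁻ t in Set.Ioc 0 r, ENNReal.ofReal (2 * (k + 1) * t) * truncMoment ν k t := by
  have h1 : ∀ᵐ s ∂ν, (if √s < r then ENNReal.ofReal ((r ^ 2 - s) ^ (k + 1)) else 0) =
      ∫⁻ t in Set.Ioc 0 r, ENNReal.ofReal (2 * (k + 1) * t) *
        (if √s < t then ENNReal.ofReal ((t ^ 2 - s) ^ k) else 0) := by
    filter_upwards [hν] with s hs
    by_cases hr : √s < r
    · rw [if_pos hr, ← lintegral_pow_sub hs hr, ← lintegral_indicator measurableSet_Ioc,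
        ← lintegral_indicator measurableSet_Ioc]
      refine lintegral_congr fun t => ?_
      by_cases ht : √s < t
      · have ht0 := (Real.sqrt_nonneg s).trans_lt ht
        by_cases htr : t ≤ r
        · rw [Set.indicator_of_mem (Set.mem_Ioc.2 ⟨ht, htr⟩),
            Set.indicator_of_mem (Set.mem_Ioc.2 ⟨ht0, htr⟩), if_pos ht,
            ENNReal.ofReal_mul (by positivity)]
        · rw [Set.indicator_of_notMem (fun h => htr h.2),
            Set.indicator_of_notMem (fun h => htr h.2)]
      · rw [Set.indicator_of_notMem (fun h => ht h.1)]
        simp [Set.indicator_apply, ht]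
    · rw [if_neg hr]
      symm
      rw [setLIntegral_eq_zero measurableSet_Ioc]
      intro t ht
      have : ¬ √s < t := fun h => hr (h.trans_le ht.2)
      simp [this]
  rw [truncMoment, lintegral_congr_ae h1, lintegral_lintegral_swap]
  · refine lintegral_congr fun t => ?_
    have hmr := (measurable_truncMoment_integrand k).comp (measurable_prodMk_left (x := t))
    simp only [Function.comp_def] at hmr
    rw [lintegral_const_mul _ hmr]
    rfl
  · have h2 := (measurable_truncMoment_integrand k).comp (measurable_swap (α := ℝ) (β := ℝ))
    simp only [Function.comp_def, Prod.fst_swap, Prod.snd_swap] at h2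
    refine Measurable.aemeasurable ?_
    exact (ENNReal.measurable_ofReal.comp (measurable_snd.const_mul _)).mul h2

/-! ### The monotone model density and its iterated primitives -/

/-- The density of the cone radius. -/
noncomputable def coneDensity (ν : Measure ℝ) (c r : ℝ) : ℝ :=
  max r 0 * (c * angularMoment 0 0 * ν.real {s | √s < r})

theorem coneDensity_of_nonpos {ν : Measure ℝ} {c r : ℝ} (hr : r ≤ 0) :
    coneDensity ν c r = 0 := by
  simp [coneDensity, max_eq_right hr]

section ConeDensity

variable {ν : Measure ℝ} [IsFiniteMeasure ν] {c : ℝ}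

/-- Both `max r 0` and `ν {√s < r}` increase with `r`; the truncation at `0` makes this true on the
whole line. -/
theorem monotone_coneDensity (hc : 0 ≤ c) : Monotone (coneDensity ν c) := by
  have hC : 0 ≤ c * angularMoment 0 0 := by
    rw [angularMoment_zero_zero]
    positivity
  intro a b hab
  refine mul_le_mul (max_le_max_right 0 hab) (mul_le_mul_of_nonneg_left ?_ hC)
    (mul_nonneg hC measureReal_nonneg) (le_max_right _ _)
  exact measureReal_mono fun s hs => lt_of_lt_of_le hs hab

theorem coneDensity_nonneg (hc : 0 ≤ c) (r : ℝ) : 0 ≤ coneDensity ν c r := by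
  rcases le_total r 0 with hr | hr
  · exact (coneDensity_of_nonpos hr).ge
  · exact (coneDensity_of_nonpos (ν := ν) (c := c) le_rfl) ▸ monotone_coneDensity hc hr

theorem ofReal_coneDensity (hc : 0 ≤ c) (r : ℝ) :
    ENNReal.ofReal (coneDensity ν c r) = ENNReal.ofReal c *
      (ENNReal.ofReal (angularMoment 0 0) * (ENNReal.ofReal r * truncMoment ν 0 r)) := by
  have h0 : 0 ≤ angularMoment 0 0 := by
    rw [angularMoment_zero_zero]
    positivity
  rw [coneDensity, truncMoment_zero, ENNReal.ofReal_mul (le_max_right _ _),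
    ENNReal.ofReal_mul (by positivity), ENNReal.ofReal_mul hc, ofReal_measureReal]
  have : ENNReal.ofReal (max r 0) = ENNReal.ofReal r := by simp [ENNReal.ofReal_max]
  rw [this]
  ring

theorem ofReal_integral_of_truncMoment (hν : ∀ᵐ s ∂ν, 0 ≤ s) {F : ℝ → ℝ} (hF : Monotone F)
    (hF0 : ∀ r, 0 ≤ F r) {d : ℝ} {k : ℕ}
    (h : ∀ t, 0 < t → ENNReal.ofReal (F t) =
      ENNReal.ofReal d * (ENNReal.ofReal (2 * (k + 1) * t) * truncMoment ν k t))
    {r : ℝ} (hr : 0 ≤ r) :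
    ENNReal.ofReal (∫ t in (0 : ℝ)..r, F t) = ENNReal.ofReal d * truncMoment ν (k + 1) r := by
  have hm := measurable_truncMoment ν k
  rw [intervalIntegral.integral_of_le hr, ofReal_integral_eq_lintegral_ofReal
    (hF.intervalIntegrable (a := 0) (b := r)).1 (Eventually.of_forall hF0),
    truncMoment_succ hν, ← lintegral_const_mul _ (by fun_prop)]
  exact setLIntegral_congr_fun measurableSet_Ioc fun t ht => h t ht.1

/-- The constants match because `2π t = π · 2t`: the angular moment `2π` of order zero becomes the
moment `π` of `cos²`. -/
theorem ofReal_primitive_coneDensity (hν : ∀ᵐ s ∂ν, 0 ≤ s) (hc : 0 ≤ c) {r : ℝ} (hr : 0 ≤ r) :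
    ENNReal.ofReal (∫ t in (0 : ℝ)..r, coneDensity ν c t) =
      ENNReal.ofReal (c * angularMoment 1 0) * truncMoment ν 1 r := by
  refine ofReal_integral_of_truncMoment hν (monotone_coneDensity hc) (coneDensity_nonneg hc)
    (fun t ht => ?_) hr
  rw [ofReal_coneDensity hc, angularMoment_zero_zero, angularMoment_one_zero,
    ← mul_assoc, ← mul_assoc, ← mul_assoc]
  congr 1
  rw [← ENNReal.ofReal_mul hc, ← ENNReal.ofReal_mul (by positivity),
    ← ENNReal.ofReal_mul (by positivity)]
  congr 1
  push_cast
  ring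

theorem ofReal_mul_primitive_coneDensity (hν : ∀ᵐ s ∂ν, 0 ≤ s) (hc : 0 ≤ c) (r : ℝ) :
    ENNReal.ofReal (max r 0 * ∫ t in (0 : ℝ)..r, coneDensity ν c t) = ENNReal.ofReal c *
      (ENNReal.ofReal (angularMoment 1 0) * (ENNReal.ofReal r * truncMoment ν 1 r)) := by
  rcases le_total r 0 with hr | hr
  · simp [max_eq_right hr, ENNReal.ofReal_of_nonpos hr]
  · rw [ENNReal.ofReal_mul (le_max_right _ _), ofReal_primitive_coneDensity hν hc hr,
      max_eq_left hr, ENNReal.ofReal_mul hc]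
    ring

/-- Here `π t = (π/4) · 4t`, and `π/4` is the angular moment of `cos² sin²`. -/
theorem ofReal_mul_primitive_primitive_coneDensity (hν : ∀ᵐ s ∂ν, 0 ≤ s) (hc : 0 ≤ c)
    (hm : Monotone fun t => max t 0 * ∫ s in (0 : ℝ)..t, coneDensity ν c s) (r : ℝ) :
    ENNReal.ofReal
        (max r 0 * ∫ t in (0 : ℝ)..r, max t 0 * ∫ s in (0 : ℝ)..t, coneDensity ν c s) =
      ENNReal.ofReal c *
        (ENNReal.ofReal (angularMoment 1 1) * (ENNReal.ofReal r * truncMoment ν 2 r)) := by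
  have hpi : 0 ≤ angularMoment 1 1 := by
    rw [angularMoment_one_one]
    positivity
  rcases le_total r 0 with hr | hr
  · simp [max_eq_right hr, ENNReal.ofReal_of_nonpos hr]
  · rw [ENNReal.ofReal_mul (le_max_right _ _), ofReal_integral_of_truncMoment hν hm
      (d := c * angularMoment 1 1) (k := 1) ?_ ?_ hr, max_eq_left hr, ENNReal.ofReal_mul hc]
    · ring
    · intro t
      rcases le_total t 0 with ht | ht
      · simp [max_eq_right ht]
      · exact mul_nonneg (le_max_right _ _)
          (intervalIntegral.integral_nonneg ht fun s _ => coneDensity_nonneg hc s)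
    · intro t ht
      rw [ofReal_mul_primitive_coneDensity hν hc, angularMoment_one_zero, angularMoment_one_one,
        ← mul_assoc, ← mul_assoc, ← mul_assoc]
      congr 1
      rw [← ENNReal.ofReal_mul hc, ← ENNReal.ofReal_mul (by positivity),
        ← ENNReal.ofReal_mul (by positivity)]
      congr 1
      push_cast
      ring

end ConeDensity

/-! ### Kernel integrals under local comparisons -/

/-- A bounded nonnegative measurable kernel supported in `[0, 1]`. -/
structure IsBoundedKernel (K : ℝ → ℝ) : Prop where
  measurable : Measurable K
  nonneg : ∀ s, 0 ≤ K s
  bounded : ∃ C, ∀ s, K s ≤ C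
  support : ∀ s, K s ≠ 0 → 0 ≤ s ∧ s ≤ 1

theorem IsBoundedKernel.mem_of_ne_zero {K : ℝ → ℝ} (hK : IsBoundedKernel K) {h t : ℝ} (hh : 0 < h)
    (ht : K (t / h) ≠ 0) : 0 ≤ t ∧ t ≤ h := by
  obtain ⟨h1, h2⟩ := hK.support _ ht
  rw [div_le_one hh] at h2
  refine ⟨?_, h2⟩
  have := mul_nonneg h1 hh.le
  rwa [div_mul_cancel₀ _ hh.ne'] at this

section KernelIntegral

variable {α : Type*} [MeasurableSpace α] {μ : Measure α} {T : α → ℝ} {K : ℝ → ℝ} {F F' : α → ℝ}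

/-- The kernel restricts to `0 ≤ T ≤ h < δ`, so a comparison valid only near `T = 0` suffices. -/
theorem kernel_ae_le (hK : IsBoundedKernel K) {c δ : ℝ}
    (hF : ∀ᵐ x ∂μ, 0 ≤ T x → T x < δ → |F x| ≤ c * F' x) {h : ℝ} (hh : 0 < h) (hhδ : h < δ) :
    ∀ᵐ x ∂μ, ‖K (T x / h) * F x‖ ≤ c * (K (T x / h) * F' x) := by
  filter_upwards [hF] with x hx
  by_cases h0 : K (T x / h) = 0
  · simp [h0]
  · obtain ⟨h1, h2⟩ := hK.mem_of_ne_zero hh h0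
    rw [norm_mul, Real.norm_eq_abs, Real.norm_eq_abs, abs_of_nonneg (hK.nonneg _), mul_left_comm]
    exact mul_le_mul_of_nonneg_left (hx h1 (h2.trans_lt hhδ)) (hK.nonneg _)

theorem kernel_integrable_of_le (hK : IsBoundedKernel K) (hT : Measurable T)
    (hFm : AEStronglyMeasurable F μ) {c δ : ℝ}
    (hF : ∀ᵐ x ∂μ, 0 ≤ T x → T x < δ → |F x| ≤ c * F' x) {h : ℝ} (hh : 0 < h) (hhδ : h < δ)
    (hi : Integrable (fun x => K (T x / h) * F' x) μ) :
    Integrable (fun x => K (T x / h) * F x) μ := by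
  refine (hi.const_mul c).mono' ?_ (kernel_ae_le hK hF hh hhδ)
  exact ((hK.measurable.comp (hT.div_const h)).aestronglyMeasurable).mul hFm

theorem kernel_isLittleO (hK : IsBoundedKernel K)
    (hF : ∀ ε > 0, ∃ δ > 0, ∀ᵐ x ∂μ, 0 ≤ T x → T x < δ → |F x| ≤ ε * F' x)
    (hi : ∀ᶠ h in 𝓝[>] (0 : ℝ), Integrable (fun x => K (T x / h) * F' x) μ) :
    (fun h => ∫ x, K (T x / h) * F x ∂μ) =o[𝓝[>] 0] fun h => ∫ x, K (T x / h) * F' x ∂μ := by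
  rw [isLittleO_iff]
  intro ε hε
  obtain ⟨δ, hδ, h1⟩ := hF ε hε
  filter_upwards [hi, Ioo_mem_nhdsGT hδ] with h h2 h3
  have h4 := kernel_ae_le hK h1 h3.1 h3.2
  calc ‖∫ x, K (T x / h) * F x ∂μ‖ ≤ ∫ x, ε * (K (T x / h) * F' x) ∂μ :=
        norm_integral_le_of_norm_le (h2.const_mul ε) h4
    _ = ε * ∫ x, K (T x / h) * F' x ∂μ := integral_const_mul _ _
    _ ≤ _ := mul_le_mul_of_nonneg_left (le_abs_self _) hε.le

theorem kernel_integrable_of_sub_le (hK : IsBoundedKernel K) (hT : Measurable T)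
    (hFm : AEStronglyMeasurable F μ)
    (hF : ∀ ε > 0, ∃ δ > 0, ∀ᵐ x ∂μ, 0 ≤ T x → T x < δ → |F x - F' x| ≤ ε * F' x)
    (hi : ∀ᶠ h in 𝓝[>] (0 : ℝ), Integrable (fun x => K (T x / h) * F' x) μ) :
    ∀ᶠ h in 𝓝[>] (0 : ℝ), Integrable (fun x => K (T x / h) * F x) μ := by
  obtain ⟨δ, hδ, h1⟩ := hF 1 one_pos
  filter_upwards [hi, Ioo_mem_nhdsGT hδ] with h h2 h3
  refine kernel_integrable_of_le hK hT hFm (c := 2) (δ := δ) ?_ h3.1 h3.2 h2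
  filter_upwards [h1] with x hx h5 h6
  have h7 := hx h5 h6
  have h8 := abs_le.1 h7
  rw [abs_le]
  constructor <;> linarith [(abs_nonneg (F x - F' x)).trans h7]

theorem kernel_isEquivalent (hK : IsBoundedKernel K) (hT : Measurable T)
    (hFm : AEStronglyMeasurable F μ)
    (hF : ∀ ε > 0, ∃ δ > 0, ∀ᵐ x ∂μ, 0 ≤ T x → T x < δ → |F x - F' x| ≤ ε * F' x)
    (hi : ∀ᶠ h in 𝓝[>] (0 : ℝ), Integrable (fun x => K (T x / h) * F' x) μ) :
    (fun h => ∫ x, K (T x / h) * F x ∂μ) ~[𝓝[>] 0] fun h => ∫ x, K (T x / h) * F' x ∂μ := by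
  refine (kernel_isLittleO hK hF hi).congr' ?_ EventuallyEq.rfl
  filter_upwards [hi, kernel_integrable_of_sub_le hK hT hFm hF hi] with h h1 h2
  simp only [Pi.sub_apply]
  rw [← integral_sub h2 h1]
  simp only [mul_sub]

end KernelIntegral

theorem kernel_mul_monotone_integrable {K D : ℝ → ℝ} (hK : IsBoundedKernel K) (hD : Monotone D)
    (hD0 : ∀ r, 0 ≤ D r) {h : ℝ} (hh : 0 < h) : Integrable fun r => K (r / h) * D r := by
  obtain ⟨C, hC⟩ := hK.bounded
  have h1 : IntegrableOn (fun _ : ℝ => C * D h) (Set.Icc 0 h) := continuous_const.integrableOn_Icc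
  have h2 := h1.integrable_indicator measurableSet_Icc
  refine h2.mono' ((hK.measurable.comp (by fun_prop)).mul hD.measurable).aestronglyMeasurable ?_
  refine Eventually.of_forall fun r => ?_
  by_cases h0 : K (r / h) = 0
  · simp only [h0, zero_mul, norm_zero]
    exact Set.indicator_nonneg (fun _ _ => mul_nonneg ((hK.nonneg 0).trans (hC 0)) (hD0 h)) _
  · have hm := hK.mem_of_ne_zero hh h0
    rw [Set.indicator_of_mem (Set.mem_Icc.2 hm),
      Real.norm_of_nonneg (mul_nonneg (hK.nonneg _) (hD0 r))]
    exact mul_le_mul (hC _) (hD hm.2) (hD0 r) ((hK.nonneg 0).trans (hC 0))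

theorem integral_withDensity_ofReal {α : Type*} [MeasurableSpace α] (μ : Measure α) {d : α → ℝ}
    (hd : Measurable d) (hd0 : ∀ x, 0 ≤ d x) (φ : α → ℝ) :
    ∫ x, φ x ∂μ.withDensity (fun x => ENNReal.ofReal (d x)) = ∫ x, φ x * d x ∂μ := by
  rw [integral_withDensity_eq_integral_toReal_smul (by fun_prop) (by simp)]
  simp [ENNReal.toReal_ofReal (hd0 _), mul_comm]

theorem integrable_withDensity_ofReal {α : Type*} [MeasurableSpace α] {μ : Measure α} {d : α → ℝ}
    (hd : Measurable d) (hd0 : ∀ x, 0 ≤ d x) {φ : α → ℝ} :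
    Integrable φ (μ.withDensity fun x => ENNReal.ofReal (d x)) ↔
      Integrable (fun x => φ x * d x) μ := by
  rw [integrable_withDensity_iff (by fun_prop) (by simp)]
  simp [ENNReal.toReal_ofReal (hd0 _)]

section Cone

variable {ν : Measure ℝ} {K D : ℝ → ℝ} {c : ℝ} {a b : ℕ}

/-- The hypothesis on `D` makes it the radial density of the weight `c y^(2a) z^(2b)`. Each moment
below uses it with its own `D`. -/
theorem lintegral_cone_eq [SFinite ν] (hν : ∀ᵐ s ∂ν, 0 ≤ s) (hc : 0 ≤ c)
    (hDc : ∀ r, ENNReal.ofReal (D r) = ENNReal.ofReal c *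
      (ENNReal.ofReal (angularMoment a b) * (ENNReal.ofReal r * truncMoment ν (a + b) r)))
    {φ : ℝ → ENNReal} (hφ : Measurable φ) :
    ∫⁻ x, φ (coneRadius x) * ENNReal.ofReal (c * (x.1.1 ^ (2 * a) * x.1.2 ^ (2 * b)))
        ∂((volume : Measure (ℝ × ℝ)).prod ν) = ∫⁻ r, φ r * ENNReal.ofReal (D r) := by
  have hm := measurable_coneRadius
  have hm' := measurable_truncMoment ν (a + b)
  simp only [hDc, ENNReal.ofReal_mul hc, mul_left_comm _ (ENNReal.ofReal c)]
  rw [lintegral_const_mul _ (by fun_prop), lintegral_const_mul _ (by fun_prop),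
    lintegral_cone_radial hν hφ]

theorem cone_integrable_and_integral_eq [SFinite ν] (hν : ∀ᵐ s ∂ν, 0 ≤ s)
    (hK : IsBoundedKernel K) (hc : 0 ≤ c) (hD : Monotone D) (hD0 : ∀ r, 0 ≤ D r)
    (hDc : ∀ r, ENNReal.ofReal (D r) = ENNReal.ofReal c *
      (ENNReal.ofReal (angularMoment a b) * (ENNReal.ofReal r * truncMoment ν (a + b) r)))
    {h : ℝ} (hh : 0 < h) :
    Integrable (fun x => K (coneRadius x / h) * (c * (x.1.1 ^ (2 * a) * x.1.2 ^ (2 * b))))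
        ((volume : Measure (ℝ × ℝ)).prod ν) ∧
      ∫ x, K (coneRadius x / h) * (c * (x.1.1 ^ (2 * a) * x.1.2 ^ (2 * b)))
        ∂((volume : Measure (ℝ × ℝ)).prod ν) = ∫ r, K (r / h) * D r := by
  have hm := measurable_coneRadius
  have hKm := hK.measurable
  have hφ : Measurable fun r => ENNReal.ofReal (K (r / h)) := by fun_prop
  have hmon : ∀ x : (ℝ × ℝ) × ℝ, 0 ≤ c * (x.1.1 ^ (2 * a) * x.1.2 ^ (2 * b)) := fun x =>
    mul_nonneg hc (mul_nonneg ((even_two_mul a).pow_nonneg _) ((even_two_mul b).pow_nonneg _))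
  have hnn : ∀ x : (ℝ × ℝ) × ℝ,
      0 ≤ K (coneRadius x / h) * (c * (x.1.1 ^ (2 * a) * x.1.2 ^ (2 * b))) := fun x =>
    mul_nonneg (hK.nonneg _) (hmon x)
  have hnn' : ∀ r, 0 ≤ K (r / h) * D r := fun r => mul_nonneg (hK.nonneg _) (hD0 r)
  have hi := kernel_mul_monotone_integrable hK hD hD0 hh
  have hmeas : Measurable fun x : (ℝ × ℝ) × ℝ =>
      K (coneRadius x / h) * (c * (x.1.1 ^ (2 * a) * x.1.2 ^ (2 * b))) := by fun_prop
  have key : ∫⁻ x, ENNReal.ofReal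
      (K (coneRadius x / h) * (c * (x.1.1 ^ (2 * a) * x.1.2 ^ (2 * b))))
        ∂((volume : Measure (ℝ × ℝ)).prod ν) = ∫⁻ r, ENNReal.ofReal (K (r / h) * D r) := by
    simp only [ENNReal.ofReal_mul (hK.nonneg _)]
    exact lintegral_cone_eq hν hc hDc hφ
  constructor
  · refine ⟨hmeas.aestronglyMeasurable, ?_⟩
    rw [hasFiniteIntegral_iff_ofReal (Eventually.of_forall hnn), key,
      ← hasFiniteIntegral_iff_ofReal (Eventually.of_forall hnn')]
    exact hi.2
  · rw [integral_eq_lintegral_of_nonneg_ae (Eventually.of_forall hnn) hmeas.aestronglyMeasurable,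
      integral_eq_lintegral_of_nonneg_ae (Eventually.of_forall hnn') hi.1, key]

end Cone

theorem abs_le_coneRadius {x : (ℝ × ℝ) × ℝ} (hx : 0 ≤ x.2) :
    |x.1.1| ≤ coneRadius x ∧ |x.1.2| ≤ coneRadius x := by
  constructor <;> refine Real.abs_le_sqrt ?_ <;> nlinarith [sq_nonneg x.1.1, sq_nonneg x.1.2]

theorem ae_cone_nonneg {ν : Measure ℝ} [SFinite ν] (hν : ∀ᵐ s ∂ν, 0 ≤ s) :
    ∀ᵐ x ∂((volume : Measure (ℝ × ℝ)).prod ν), 0 ≤ x.2 :=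
  Measure.quasiMeasurePreserving_snd.ae hν

/-! ### First-order expansions at the centre -/

/-- Near a point where a product of densities is continuous, it is close to its value. -/
theorem exists_abs_mul_sub_le {p q : ℝ → ℝ} (hp : ContinuousAt p 0) (hq : ContinuousAt q 0)
    (hc : 0 < p 0 * q 0) {ε : ℝ} (hε : 0 < ε) :
    ∃ δ > 0, ∀ y z, |y| < δ → |z| < δ → |p y * q z - p 0 * q 0| ≤ ε * (p 0 * q 0) := by
  have h : ContinuousAt (fun x : ℝ × ℝ => p x.1 * q x.2) (0, 0) :=
    (ContinuousAt.comp (f := Prod.fst) hp continuousAt_fst).mul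
      (ContinuousAt.comp (f := Prod.snd) hq continuousAt_snd)
  obtain ⟨δ, hδ, h1⟩ := Metric.continuousAt_iff.1 h _ (mul_pos hε hc)
  refine ⟨δ, hδ, fun y z hy hz => ?_⟩
  have := h1 (x := (y, z)) (by simp [Prod.dist_eq, hy, hz])
  rw [Real.dist_eq] at this
  exact this.le

/-- The antisymmetric part of a function, normalised by the derivative at `0`, is close to the
identity near `0`. -/
theorem exists_abs_oddPart_sub_le {p : ℝ → ℝ} {p' : ℝ} (hp : HasDerivAt p p' 0) (hp' : p' ≠ 0)
    {ε : ℝ} (hε : 0 < ε) :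
    ∃ δ > 0, ∀ y, |y| < δ → |(p y - p (-y)) / (2 * p') - y| ≤ ε * |y| := by
  have hneg : HasDerivAt (fun y => p (-y)) (-p') 0 := by
    have h0 : HasDerivAt p p' (-(0 : ℝ)) := by simpa using hp
    exact (HasDerivAt.scomp (0 : ℝ) h0 (hasDerivAt_neg (0 : ℝ))).congr_deriv (by simp)
  have h : HasDerivAt (fun y => (p y - p (-y)) / (2 * p')) 1 0 := by
    refine ((hp.sub hneg).div_const (2 * p')).congr_deriv ?_
    field_simp
    norm_num
  have h1 := (hasDerivAt_iff_isLittleO.1 h).def hε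
  obtain ⟨δ, hδ, h2⟩ := Metric.eventually_nhds_iff.1 h1
  refine ⟨δ, hδ, fun y hy => ?_⟩
  have := h2 (y := y) (by simpa [Real.dist_eq] using hy)
  simpa using this

/-- Writing `u v - y z` through `u - y` and `v - z` leaves three error terms, each at most `η |y|
|z|`; hence `3 η ≤ ε`. -/
theorem abs_mul_mul_sub_le {y z u v η ε : ℝ} (hη0 : 0 ≤ η) (hη1 : η ≤ 1) (hη : 3 * η ≤ ε)
    (hu : |u - y| ≤ η * |y|) (hv : |v - z| ≤ η * |z|) :
    |y * z * (u * v) - y ^ 2 * z ^ 2| ≤ ε * (y ^ 2 * z ^ 2) := by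
  have h1 : y * z * (u * v) - y ^ 2 * z ^ 2 =
      (y * z) * ((u - y) * (v - z) + (u - y) * z + y * (v - z)) := by ring
  have h2 : |(u - y) * (v - z) + (u - y) * z + y * (v - z)| ≤ ε * (|y| * |z|) := by
    have ha : |(u - y) * (v - z)| ≤ η * (|y| * |z|) := by
      rw [abs_mul]
      calc _ ≤ (η * |y|) * (η * |z|) := mul_le_mul hu hv (abs_nonneg _) (by positivity)
        _ = η * η * (|y| * |z|) := by ring
        _ ≤ η * 1 * (|y| * |z|) := by gcongr
        _ = _ := by ring
    have hb : |(u - y) * z| ≤ η * (|y| * |z|) := by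
      rw [abs_mul, ← mul_assoc]
      exact mul_le_mul_of_nonneg_right hu (abs_nonneg _)
    have hc : |y * (v - z)| ≤ η * (|y| * |z|) := by
      rw [abs_mul, mul_left_comm]
      exact mul_le_mul_of_nonneg_left hv (abs_nonneg _)
    have hd : 3 * η * (|y| * |z|) ≤ ε * (|y| * |z|) := by gcongr
    have := abs_add_three ((u - y) * (v - z)) ((u - y) * z) (y * (v - z))
    linarith
  rw [h1, abs_mul, abs_mul]
  calc |y| * |z| * _ ≤ |y| * |z| * (ε * (|y| * |z|)) := by gcongr
    _ = ε * (|y| ^ 2 * |z| ^ 2) := by ring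
    _ = _ := by rw [sq_abs, sq_abs]

/-! ### The cone law and the comparison of `g` with the model density -/

/-- The product law with densities `p`, `q` on the plane and law `ν` of the squared radius of the
remaining coordinates. -/
noncomputable def coneLaw (ν : Measure ℝ) (p q : ℝ → ℝ) : Measure ((ℝ × ℝ) × ℝ) :=
  ((volume : Measure (ℝ × ℝ)).prod ν).withDensity fun x => ENNReal.ofReal (p x.1.1 * q x.1.2)

theorem setLIntegral_density_coneRadius {ν : Measure ℝ} {p q g : ℝ → ℝ} {ε : ℝ}
    (h : LocalPCA.HasDensityOn (coneLaw ν p q) coneRadius g (Set.Iio ε)) {B : Set ℝ}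
    (hB : MeasurableSet B) (hBε : B ⊆ Set.Iio ε) :
    ∫⁻ r in B, ENNReal.ofReal (g r) =
      ∫⁻ x, B.indicator 1 (coneRadius x) * ENNReal.ofReal (p x.1.1 * q x.1.2)
        ∂((volume : Measure (ℝ × ℝ)).prod ν) := by
  have hm := measurable_coneRadius
  have h1 := congrArg (fun μ => μ B) h.law_eq
  simp only [Measure.restrict_apply hB, Set.inter_eq_left.2 hBε] at h1
  rw [← withDensity_apply _ hB, ← h1, Measure.map_apply hm hB, coneLaw,
    withDensity_apply _ (hm hB), ← lintegral_indicator (hm hB)]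
  refine lintegral_congr fun x => ?_
  by_cases hx : coneRadius x ∈ B
  · rw [Set.indicator_of_mem (Set.mem_preimage.2 hx), Set.indicator_of_mem hx, Pi.one_apply,
      one_mul]
  · rw [Set.indicator_of_notMem (s := B) hx, Set.indicator_of_notMem (s := coneRadius ⁻¹' B) hx,
      zero_mul]

/-- The data entering the asymptotics of second moments on small balls. -/
structure ConeSetting (ν : Measure ℝ) (p q : ℝ → ℝ) (p' q' : ℝ) (g ρ : ℝ → ℝ) : Prop where
  nu_nonneg : ∀ᵐ s ∂ν, 0 ≤ s
  measurable_p : Measurable p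
  measurable_q : Measurable q
  p_nonneg : ∀ y, 0 ≤ p y
  q_nonneg : ∀ y, 0 ≤ q y
  p_ne : p 0 ≠ 0
  q_ne : q 0 ≠ 0
  deriv_p : HasDerivAt p p' 0
  deriv_q : HasDerivAt q q' 0
  deriv_p_ne : p' ≠ 0
  deriv_q_ne : q' ≠ 0
  finite_law : IsFiniteMeasure (coneLaw ν p q)
  density : ∃ ε > 0, LocalPCA.HasDensityOn (coneLaw ν p q) coneRadius g (Set.Iio ε)
  gamma : LocalPCA.IsGammaVaryingAtZero g ρ

namespace ConeSetting

variable {ν : Measure ℝ} {p q : ℝ → ℝ} {p' q' : ℝ} {g ρ : ℝ → ℝ}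

theorem mul_pos (S : ConeSetting ν p q p' q' g ρ) : 0 < p 0 * q 0 :=
  _root_.mul_pos (lt_of_le_of_ne (S.p_nonneg 0) S.p_ne.symm)
    (lt_of_le_of_ne (S.q_nonneg 0) S.q_ne.symm)

theorem g_nonneg (S : ConeSetting ν p q p' q' g ρ) (t : ℝ) : 0 ≤ g t := by
  obtain ⟨_, _, h⟩ := S.density
  exact h.nonneg t

theorem measurable_g (S : ConeSetting ν p q p' q' g ρ) : Measurable g := by
  obtain ⟨_, _, h⟩ := S.density
  exact h.measurable

theorem mul_nonneg (S : ConeSetting ν p q p' q' g ρ) (x : (ℝ × ℝ) × ℝ) :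
    0 ≤ p x.1.1 * q x.1.2 :=
  _root_.mul_nonneg (S.p_nonneg _) (S.q_nonneg _)

theorem measurable_mul (S : ConeSetting ν p q p' q' g ρ) :
    Measurable fun x : (ℝ × ℝ) × ℝ => p x.1.1 * q x.1.2 := by
  have := S.measurable_p
  have := S.measurable_q
  fun_prop

variable [IsFiniteMeasure ν]

theorem setLIntegral_coneDensity (S : ConeSetting ν p q p' q' g ρ) {d : ℝ} (hd : 0 ≤ d)
    {B : Set ℝ} (hB : MeasurableSet B) :
    ∫⁻ r in B, ENNReal.ofReal (d * coneDensity ν (p 0 * q 0) r) =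
      ∫⁻ x, B.indicator 1 (coneRadius x) * ENNReal.ofReal (d * (p 0 * q 0))
        ∂((volume : Measure (ℝ × ℝ)).prod ν) := by
  have hm := measurable_coneRadius
  have hφ : Measurable (B.indicator (1 : ℝ → ENNReal)) := measurable_one.indicator hB
  have h1 := lintegral_cone_eq (a := 0) (b := 0) S.nu_nonneg S.mul_pos.le
    (fun r => ofReal_coneDensity S.mul_pos.le r) hφ
  have hmG := (monotone_coneDensity (ν := ν) S.mul_pos.le).measurable
  simp only [ENNReal.ofReal_mul hd, mul_left_comm _ (ENNReal.ofReal d)]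
  rw [lintegral_const_mul _ (by fun_prop), lintegral_const_mul _ (by fun_prop),
    ← lintegral_indicator hB]
  congr 1
  simp only [mul_zero, pow_zero, mul_one] at h1
  rw [h1]
  refine lintegral_congr fun r => ?_
  by_cases hr : r ∈ B <;> simp [hr]

/-- For Borel sets `B` of small radii, the integrals over `B` of `g` and of the model are integrals
over the same region of `p q` and of the constant `p 0 * q 0`. These integrands differ by a relative
error `ε`, and inequalities over all such `B` pass to the densities. -/
theorem ae_abs_sub_coneDensity_le (S : ConeSetting ν p q p' q' g ρ) {ε : ℝ} (hε : 0 < ε) :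
    ∃ δ > 0, ∀ᵐ r, r < δ →
      |g r - coneDensity ν (p 0 * q 0) r| ≤ ε * coneDensity ν (p 0 * q 0) r := by
  obtain ⟨ε₀, hε₀, hd⟩ := S.density
  -- Keeps `1 - ε` nonnegative, as the lower bound in `ENNReal` requires.
  wlog hε1 : ε ≤ 1 generalizing ε
  · obtain ⟨δ, hδ, h⟩ := this one_pos le_rfl
    refine ⟨δ, hδ, ?_⟩
    filter_upwards [h] with r hr hr'
    refine (hr hr').trans (mul_le_mul_of_nonneg_right (le_of_not_ge hε1) ?_)
    exact coneDensity_nonneg S.mul_pos.le r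
  obtain ⟨δ₁, hδ₁, hpq⟩ := exists_abs_mul_sub_le S.deriv_p.continuousAt S.deriv_q.continuousAt
    S.mul_pos hε
  refine ⟨min δ₁ ε₀, lt_min hδ₁ hε₀, ?_⟩
  set δ := min δ₁ ε₀
  have hmG := (monotone_coneDensity (ν := ν) S.mul_pos.le).measurable
  have hmg := S.measurable_g
  have hbound : ∀ B ⊆ Set.Iio δ, ∀ᵐ x ∂((volume : Measure (ℝ × ℝ)).prod ν), coneRadius x ∈ B →
      |p x.1.1 * q x.1.2 - p 0 * q 0| ≤ ε * (p 0 * q 0) := by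
    intro B hB
    filter_upwards [ae_cone_nonneg S.nu_nonneg] with x hx hxB
    have h1 := abs_le_coneRadius hx
    have h2 : coneRadius x < δ₁ := (hB hxB).trans_le (min_le_left _ _)
    exact hpq _ _ (h1.1.trans_lt h2) (h1.2.trans_lt h2)
  have hupper : ∀ᵐ r ∂(volume.restrict (Set.Iio δ)), ENNReal.ofReal (g r) ≤
      ENNReal.ofReal ((1 + ε) * coneDensity ν (p 0 * q 0) r) := by
    refine ae_le_of_forall_setLIntegral_le_of_sigmaFinite (by fun_prop) fun s hs _ => ?_
    have hB := hs.inter (measurableSet_Iio (a := δ))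
    rw [Measure.restrict_restrict hs, setLIntegral_density_coneRadius hd hB
      (fun r hr => lt_of_lt_of_le (Set.mem_Iio.1 hr.2) (min_le_right _ _)),
      S.setLIntegral_coneDensity (by linarith) hB]
    refine lintegral_mono_ae ?_
    filter_upwards [hbound _ Set.inter_subset_right] with x hx
    by_cases hxB : coneRadius x ∈ s ∩ Set.Iio δ
    · refine mul_le_mul_right (ENNReal.ofReal_le_ofReal ?_) _
      have := (abs_le.1 (hx hxB)).2
      linarith
    · rw [Set.indicator_of_notMem hxB, zero_mul, zero_mul]
  have hlower : ∀ᵐ r ∂(volume.restrict (Set.Iio δ)),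
      ENNReal.ofReal ((1 - ε) * coneDensity ν (p 0 * q 0) r) ≤ ENNReal.ofReal (g r) := by
    refine ae_le_of_forall_setLIntegral_le_of_sigmaFinite (by fun_prop) fun s hs _ => ?_
    have hB := hs.inter (measurableSet_Iio (a := δ))
    rw [Measure.restrict_restrict hs, setLIntegral_density_coneRadius hd hB
      (fun r hr => lt_of_lt_of_le (Set.mem_Iio.1 hr.2) (min_le_right _ _)),
      S.setLIntegral_coneDensity (by linarith) hB]
    refine lintegral_mono_ae ?_
    filter_upwards [hbound _ Set.inter_subset_right] with x hx
    by_cases hxB : coneRadius x ∈ s ∩ Set.Iio δ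
    · refine mul_le_mul_right (ENNReal.ofReal_le_ofReal ?_) _
      have := (abs_le.1 (hx hxB)).1
      linarith
    · rw [Set.indicator_of_notMem hxB, zero_mul, zero_mul]
  filter_upwards [(ae_restrict_iff' measurableSet_Iio).1 hupper,
    (ae_restrict_iff' measurableSet_Iio).1 hlower] with r h1 h2 hr
  have h0 := coneDensity_nonneg (ν := ν) S.mul_pos.le r
  have h3 := (ENNReal.ofReal_le_ofReal_iff (by positivity)).1 (h1 hr)
  have h4 := (ENNReal.ofReal_le_ofReal_iff (S.g_nonneg r)).1 (h2 hr)
  rw [abs_le]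
  constructor <;> linarith

end ConeSetting

/-! ### Moments on small balls under the cone law -/

section Law

variable {α : Type*} [MeasurableSpace α] {μ : Measure α} {T : α → ℝ} {K g u : ℝ → ℝ} {ε h : ℝ}

/-- The density is known only below `ε`, but for `h < ε` the kernel vanishes beyond. -/
theorem integral_kernel_eq_of_hasDensityOn (hT : Measurable T)
    (hd : LocalPCA.HasDensityOn μ T g (Set.Iio ε)) (hK : IsBoundedKernel K) (hu : Measurable u)
    (hh : 0 < h) (hhε : h < ε) :
    ∫ x, K (T x / h) * u (T x) ∂μ = ∫ r, K (r / h) * (u r * g r) := by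
  have hKm := hK.measurable
  have hφ : Measurable fun r => K (r / h) * u r := by fun_prop
  have h0 : ∀ r ∉ Set.Iio ε, K (r / h) * u r = 0 := by
    intro r hr
    by_contra hne
    exact hr ((hK.mem_of_ne_zero hh (left_ne_zero_of_mul hne)).2.trans_lt hhε)
  rw [← integral_map hT.aemeasurable (f := fun r => K (r / h) * u r) hφ.aestronglyMeasurable,
    ← setIntegral_eq_integral_of_forall_compl_eq_zero h0, hd.law_eq,
    setIntegral_eq_integral_of_forall_compl_eq_zero h0,
    integral_withDensity_ofReal _ hd.measurable hd.nonneg]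
  simp only [mul_assoc]

theorem integrable_kernel_iff_of_hasDensityOn (hT : Measurable T)
    (hd : LocalPCA.HasDensityOn μ T g (Set.Iio ε)) (hK : IsBoundedKernel K) (hu : Measurable u)
    (hh : 0 < h) (hhε : h < ε) :
    Integrable (fun x => K (T x / h) * u (T x)) μ ↔
      Integrable fun r => K (r / h) * (u r * g r) := by
  have hKm := hK.measurable
  have hφ : Measurable fun r => K (r / h) * u r := by fun_prop
  have h0 : Function.support (fun r => K (r / h) * u r) ⊆ Set.Iio ε := by
    intro r hne
    exact (hK.mem_of_ne_zero hh (left_ne_zero_of_mul hne)).2.trans_lt hhε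
  have h1 := integrable_map_measure (μ := μ) (f := T) (g := fun r => K (r / h) * u r)
    hφ.aestronglyMeasurable hT.aemeasurable
  simp only [Function.comp_def] at h1
  rw [← h1, ← integrableOn_iff_integrable_of_support_subset h0, IntegrableOn, hd.law_eq,
    ← IntegrableOn, integrableOn_iff_integrable_of_support_subset h0,
    integrable_withDensity_ofReal hd.measurable hd.nonneg]
  simp only [mul_assoc]

end Law

namespace ConeSetting

variable {ν : Measure ℝ} {p q : ℝ → ℝ} {p' q' : ℝ} {g ρ K : ℝ → ℝ}

/-- Passing from an asymptotic equivalence of radial functions to one of kernel integrals. -/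
theorem radial_isEquivalent (S : ConeSetting ν p q p' q' g ρ) (hK : IsBoundedKernel K)
    {D u : ℝ → ℝ} (hu : Measurable u) (hu0 : u 0 = 0) (hD : MonotoneGammaVarying D ρ)
    (hD0 : D 0 = 0) (hDu : D ~[𝓝[>] 0] fun r => u r * g r) :
    (∀ᶠ h in 𝓝[>] (0 : ℝ),
      Integrable (fun x => K (coneRadius x / h) * u (coneRadius x)) (coneLaw ν p q)) ∧
    (fun h => ∫ r, K (r / h) * D r) ~[𝓝[>] 0]
      fun h => ∫ x, K (coneRadius x / h) * u (coneRadius x) ∂coneLaw ν p q := by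
  have hmg := S.measurable_g
  obtain ⟨ε₀, hε₀, hd⟩ := S.density
  have hF : ∀ ε > 0, ∃ δ > 0, ∀ᵐ r : ℝ, 0 ≤ r → r < δ → |u r * g r - D r| ≤ ε * D r := by
    intro ε hε
    obtain ⟨δ, hδ, h⟩ := mem_nhdsGT_iff_exists_Ioo_subset.1 (hDu.symm.isLittleO.def hε)
    refine ⟨δ, hδ, Eventually.of_forall fun r hr hrδ => ?_⟩
    -- The equivalence says nothing at `r = 0`; there both sides vanish.
    rcases hr.eq_or_lt with rfl | hr
    · simp [hu0, hD0]
    · have := h ⟨hr, hrδ⟩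
      simpa [abs_of_nonneg (hD.nonneg r)] using this
  have hi : ∀ᶠ h in 𝓝[>] (0 : ℝ), Integrable (fun r => K (r / h) * D r) := by
    filter_upwards [self_mem_nhdsWithin] with h hh
    exact kernel_mul_monotone_integrable hK hD.mono hD.nonneg hh
  have hum : AEStronglyMeasurable (fun r => u r * g r) volume :=
    (hu.mul hmg).aestronglyMeasurable
  constructor
  · filter_upwards [kernel_integrable_of_sub_le hK measurable_id hum hF hi,
      Ioo_mem_nhdsGT hε₀] with h h1 h2
    exact (integrable_kernel_iff_of_hasDensityOn measurable_coneRadius hd hK hu h2.1 h2.2).2 h1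
  · refine (kernel_isEquivalent hK measurable_id hum hF hi).symm.congr_right ?_
    filter_upwards [Ioo_mem_nhdsGT hε₀] with h h2
    exact (integral_kernel_eq_of_hasDensityOn measurable_coneRadius hd hK hu h2.1 h2.2).symm

theorem integral_coneLaw (S : ConeSetting ν p q p' q' g ρ) (φ : (ℝ × ℝ) × ℝ → ℝ) :
    ∫ x, φ x ∂coneLaw ν p q = ∫ x, φ x * (p x.1.1 * q x.1.2)
      ∂((volume : Measure (ℝ × ℝ)).prod ν) :=
  integral_withDensity_ofReal _ S.measurable_mul S.mul_nonneg φ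

variable [IsFiniteMeasure ν]

theorem aux_small (S : ConeSetting ν p q p' q' g ρ) :
    Tendsto (fun h => ρ h / h) (𝓝[>] 0) (𝓝 0) :=
  S.gamma.aux_small (fun _ => coneDensity_of_nonpos) fun _ => S.ae_abs_sub_coneDensity_le

/-- Eventually `ρ r < r`, so `r ρ(r)` is at most `r²`, hence small. -/
theorem exists_aux_le (S : ConeSetting ν p q p' q' g ρ) {ε : ℝ} (hε : 0 < ε) :
    ∃ δ > 0, ∀ r, 0 ≤ r → r < δ → |r ^ 2 * ρ r ^ 2| ≤ ε * (r * ρ r) := by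
  have hev : ∀ᶠ r in 𝓝[>] (0 : ℝ), 0 < ρ r ∧ ρ r / r < 1 ∧ r ^ 2 < ε := by
    have h2 : Tendsto (fun r : ℝ => r ^ 2) (𝓝[>] 0) (𝓝 0) := by
      have : Tendsto (fun r : ℝ => r ^ 2) (𝓝 0) (𝓝 (0 ^ 2)) := (continuous_pow 2).tendsto 0
      rw [zero_pow two_ne_zero] at this
      exact tendsto_nhdsWithin_of_tendsto_nhds this
    filter_upwards [S.gamma.aux_pos, S.aux_small.eventually_lt_const one_pos,
      h2.eventually_lt_const hε] with r h1 h2 h3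
    exact ⟨h1, h2, h3⟩
  obtain ⟨δ, hδ, h⟩ := mem_nhdsGT_iff_exists_Ioo_subset.1 hev
  refine ⟨δ, hδ, fun r hr hrδ => ?_⟩
  rcases hr.eq_or_lt with rfl | hr
  · simp
  · obtain ⟨h1, h2, h3⟩ := h ⟨hr, hrδ⟩
    rw [div_lt_one hr] at h2
    have h4 : 0 < r * ρ r := _root_.mul_pos hr h1
    rw [abs_of_nonneg (by positivity)]
    have h5 : r * ρ r ≤ r * r := by gcongr
    calc r ^ 2 * ρ r ^ 2 = (r * ρ r) * (r * ρ r) := by ring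
      _ ≤ ε * (r * ρ r) := by
        refine mul_le_mul_of_nonneg_right ?_ h4.le
        linarith [sq r]

theorem primitive_mono (S : ConeSetting ν p q p' q' g ρ) :
    MonotoneGammaVarying (fun r => max r 0 * ∫ t in (0 : ℝ)..r, coneDensity ν (p 0 * q 0) t) ρ :=
  ((S.gamma.monotoneGammaVarying S.g_nonneg (monotone_coneDensity S.mul_pos.le)
    (fun _ => coneDensity_of_nonpos) fun _ => S.ae_abs_sub_coneDensity_le).primitive
    fun _ => coneDensity_of_nonpos).max_mul

theorem primitive_primitive_mono (S : ConeSetting ν p q p' q' g ρ) :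
    MonotoneGammaVarying (fun r => max r 0 * ∫ t in (0 : ℝ)..r, max t 0 *
      ∫ s in (0 : ℝ)..t, coneDensity ν (p 0 * q 0) s) ρ :=
  (S.primitive_mono.primitive fun r hr => by simp [max_eq_right hr]).max_mul

/-- Replacing `p q` by `p 0 * q 0` costs a relative error tending to `0`. The weight `y²` then has
radial density `r ∫₀ʳ G`, which is equivalent to `r ρ g`. -/
theorem first_moment (S : ConeSetting ν p q p' q' g ρ) (hK : IsBoundedKernel K) :
    (∀ᶠ h in 𝓝[>] (0 : ℝ), Integrable
      (fun x => K (coneRadius x / h) * (coneRadius x * ρ (coneRadius x))) (coneLaw ν p q)) ∧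
    (fun h => ∫ x, K (coneRadius x / h) * x.1.1 ^ 2 ∂coneLaw ν p q) ~[𝓝[>] 0]
      fun h => ∫ x, K (coneRadius x / h) * (coneRadius x * ρ (coneRadius x)) ∂coneLaw ν p q := by
  have hmρ := S.gamma.measurable_aux
  have hmpq := S.measurable_mul
  have hcone : ∀ h : ℝ, 0 < h → _ := fun h hh => cone_integrable_and_integral_eq (a := 1) (b := 0)
    S.nu_nonneg hK S.mul_pos.le S.primitive_mono.mono S.primitive_mono.nonneg
    (fun r => ofReal_mul_primitive_coneDensity S.nu_nonneg S.mul_pos.le r) hh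
  obtain ⟨h1, h2⟩ := S.radial_isEquivalent hK (u := fun r => r * ρ r) (by fun_prop) (by simp)
    S.primitive_mono (by simp)
    (S.gamma.isEquivalent_primitive S.g_nonneg (monotone_coneDensity S.mul_pos.le)
      (fun _ => coneDensity_of_nonpos) fun _ => S.ae_abs_sub_coneDensity_le)
  refine ⟨h1, IsEquivalent.trans ?_ h2⟩
  have h3 := kernel_isEquivalent (μ := (volume : Measure (ℝ × ℝ)).prod ν) (T := coneRadius)
    (F := fun x => x.1.1 ^ 2 * (p x.1.1 * q x.1.2))
    (F' := fun x => p 0 * q 0 * (x.1.1 ^ (2 * 1) * x.1.2 ^ (2 * 0))) hK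
    measurable_coneRadius (by fun_prop) ?_ ?_
  · refine (h3.congr_left (Eventually.of_forall fun h => ?_)).congr_right ?_
    · simp only
      rw [S.integral_coneLaw]
      simp only [mul_assoc]
    · filter_upwards [self_mem_nhdsWithin] with h hh
      exact (hcone h hh).2
  · intro ε hε
    obtain ⟨δ, hδ, hpq⟩ := exists_abs_mul_sub_le S.deriv_p.continuousAt S.deriv_q.continuousAt
      S.mul_pos hε
    refine ⟨δ, hδ, ?_⟩
    filter_upwards [ae_cone_nonneg S.nu_nonneg] with x hx _ hxδ
    have h1 := abs_le_coneRadius hx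
    have h2 := hpq _ _ (h1.1.trans_lt hxδ) (h1.2.trans_lt hxδ)
    simp only [mul_one, mul_zero, pow_zero]
    calc |x.1.1 ^ 2 * (p x.1.1 * q x.1.2) - p 0 * q 0 * x.1.1 ^ 2|
        = x.1.1 ^ 2 * |p x.1.1 * q x.1.2 - p 0 * q 0| := by
          rw [← abs_of_nonneg (sq_nonneg x.1.1), ← abs_mul, abs_of_nonneg (sq_nonneg x.1.1)]
          congr 1
          ring
      _ ≤ x.1.1 ^ 2 * (ε * (p 0 * q 0)) := by gcongr
      _ = _ := by ring
  · filter_upwards [self_mem_nhdsWithin] with h hh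
    exact (hcone h hh).1

theorem second_isLittleO_first (S : ConeSetting ν p q p' q' g ρ) (hK : IsBoundedKernel K) :
    (∀ᶠ h in 𝓝[>] (0 : ℝ), Integrable
      (fun x => K (coneRadius x / h) * (coneRadius x ^ 2 * ρ (coneRadius x) ^ 2))
        (coneLaw ν p q)) ∧
    (fun h => ∫ x, K (coneRadius x / h) * (coneRadius x ^ 2 * ρ (coneRadius x) ^ 2)
        ∂coneLaw ν p q) =o[𝓝[>] 0]
      fun h => ∫ x, K (coneRadius x / h) * (coneRadius x * ρ (coneRadius x)) ∂coneLaw ν p q := by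
  have hmρ := S.gamma.measurable_aux
  have hm := measurable_coneRadius
  obtain ⟨h1, -⟩ := S.first_moment hK
  constructor
  · obtain ⟨δ, hδ, h⟩ := S.exists_aux_le one_pos
    filter_upwards [h1, Ioo_mem_nhdsGT hδ] with b hb hbδ
    exact kernel_integrable_of_le hK hm (by fun_prop) (c := 1) (δ := δ)
      (F' := fun x => coneRadius x * ρ (coneRadius x))
      (Eventually.of_forall fun x => h _) hbδ.1 hbδ.2 hb
  · refine kernel_isLittleO hK (fun ε hε => ?_) h1
    obtain ⟨δ, hδ, h⟩ := S.exists_aux_le hε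
    exact ⟨δ, hδ, Eventually.of_forall fun x => h _⟩

/-- The reference measure and the radius are invariant under the sign changes of `y` and `z`.
Averaging over the four of them leaves only the odd parts of `p` and `q`. Without this, replacing `p
q` by its value at the centre would leave an error too large for the order of `w`. -/
theorem integral_antisymm (S : ConeSetting ν p q p' q' g ρ) (hK : IsBoundedKernel K) {h : ℝ}
    (hh : 0 < h) :
    ∫ x, K (coneRadius x / h) * (x.1.1 * x.1.2) ∂coneLaw ν p q =
      ∫ x, K (coneRadius x / h) * (x.1.1 * x.1.2 * ((p x.1.1 - p (-x.1.1)) / 2 *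
        ((q x.1.2 - q (-x.1.2)) / 2))) ∂((volume : Measure (ℝ × ℝ)).prod ν) := by
  have hm := measurable_coneRadius
  have hKm := hK.measurable
  have hmp := S.measurable_p
  have hmq := S.measurable_q
  set m := (volume : Measure (ℝ × ℝ)).prod ν
  set f : (ℝ × ℝ) × ℝ → ℝ := fun x =>
    K (coneRadius x / h) * (x.1.1 * x.1.2) * (p x.1.1 * q x.1.2) with hf
  have hfm : Measurable f := by fun_prop
  -- Where the kernel is nonzero both coordinates are at most `h` in absolute value, so the
  -- integrand is bounded under the finite cone law.
  have hint : Integrable f m := by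
    refine (integrable_withDensity_ofReal S.measurable_mul S.mul_nonneg).1 ?_
    obtain ⟨C, hC⟩ := hK.bounded
    have : IsFiniteMeasure (m.withDensity fun x => ENNReal.ofReal (p x.1.1 * q x.1.2)) :=
      S.finite_law
    have hC0 : 0 ≤ C := (hK.nonneg 0).trans (hC 0)
    have hae : ∀ᵐ x ∂coneLaw ν p q, 0 ≤ x.2 :=
      (withDensity_absolutelyContinuous _ _).ae_le (ae_cone_nonneg S.nu_nonneg)
    refine Integrable.of_bound (C := C * (h * h)) ?_ ?_
    · exact Measurable.aestronglyMeasurable (by fun_prop)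
    · filter_upwards [hae] with x hx
      by_cases h0 : K (coneRadius x / h) = 0
      · rw [h0, zero_mul, norm_zero]
        positivity
      · have h1 := (hK.mem_of_ne_zero hh h0).2
        have h2 := abs_le_coneRadius hx
        rw [norm_mul, norm_mul, Real.norm_of_nonneg (hK.nonneg _)]
        exact mul_le_mul (hC _) (mul_le_mul (h2.1.trans h1) (h2.2.trans h1) (norm_nonneg _) hh.le)
          (by positivity) hC0
  have hnegm : MeasurePreserving (fun y : ℝ => -y) volume volume := Measure.measurePreserving_neg _
  have hid : MeasurePreserving (fun y : ℝ => y) volume volume := MeasurePreserving.id _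
  have hσ₁ : MeasurePreserving (fun x : (ℝ × ℝ) × ℝ => ((-x.1.1, x.1.2), x.2)) m m :=
    (hnegm.prod hid).prod (MeasurePreserving.id ν)
  have hσ₂ : MeasurePreserving (fun x : (ℝ × ℝ) × ℝ => ((x.1.1, -x.1.2), x.2)) m m :=
    (hid.prod hnegm).prod (MeasurePreserving.id ν)
  have htrans : ∀ {σ : (ℝ × ℝ) × ℝ → (ℝ × ℝ) × ℝ} {k : (ℝ × ℝ) × ℝ → ℝ},
      MeasurePreserving σ m m → Measurable k → Integrable k m →
      Integrable (fun x => k (σ x)) m ∧ ∫ x, k (σ x) ∂m = ∫ x, k x ∂m := by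
    intro σ k hσ hk hki
    refine ⟨(hσ.integrable_comp hk.aestronglyMeasurable).2 hki, ?_⟩
    have := integral_map (μ := m) hσ.measurable.aemeasurable (f := k) hk.aestronglyMeasurable
    rw [← this, hσ.map_eq]
  obtain ⟨hi1, he1⟩ := htrans hσ₁ hfm hint
  obtain ⟨hi2, he2⟩ := htrans hσ₂ hfm hint
  obtain ⟨hi3, he3⟩ := htrans hσ₂ (hfm.comp hσ₁.measurable) hi1
  simp only [Function.comp_def] at hi3 he3
  rw [S.integral_coneLaw]
  have h4 : ∫ x, f x ∂m = 1 / 4 * (∫ x, f x ∂m + ∫ x, f ((-x.1.1, x.1.2), x.2) ∂m +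
      ∫ x, f ((x.1.1, -x.1.2), x.2) ∂m + ∫ x, f ((-x.1.1, -x.1.2), x.2) ∂m) := by
    rw [he3, he2, he1]
    ring
  have hi12 : Integrable (fun x => f x + f ((-x.1.1, x.1.2), x.2)) m := hint.add hi1
  have hi123 : Integrable (fun x => f x + f ((-x.1.1, x.1.2), x.2) +
    f ((x.1.1, -x.1.2), x.2)) m := hi12.add hi2
  rw [h4, ← integral_add hint hi1, ← integral_add hi12 hi2, ← integral_add hi123 hi3,
    ← integral_const_mul]
  refine integral_congr_ae (Eventually.of_forall fun x => ?_)
  simp only [hf, coneRadius, neg_sq]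
  ring

/-- After antisymmetrisation the weight is `y z` times odd parts close to `p' y` and `q' z`, that
is, a multiple of `y² z²` to leading order. Normalising by `p 0 * q 0 / (p' q')` gives the model
weight with radial density `r ∫₀ʳ t ∫₀ᵗ G`, and the inverse factor is the limiting constant. -/
theorem mixed_moment (S : ConeSetting ν p q p' q' g ρ) (hK : IsBoundedKernel K) :
    (fun h => ∫ x, K (coneRadius x / h) * (x.1.1 * x.1.2) ∂coneLaw ν p q) ~[𝓝[>] 0]
      fun h => (∫ x, K (coneRadius x / h) * (coneRadius x ^ 2 * ρ (coneRadius x) ^ 2)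
        ∂coneLaw ν p q) * (p' / p 0 * (q' / q 0)) := by
  have hmρ := S.gamma.measurable_aux
  have hmp := S.measurable_p
  have hmq := S.measurable_q
  have hp0 := S.p_ne
  have hq0 := S.q_ne
  have hp' := S.deriv_p_ne
  have hq' := S.deriv_q_ne
  have hcone : ∀ h : ℝ, 0 < h → _ := fun h hh => cone_integrable_and_integral_eq (a := 1) (b := 1)
    S.nu_nonneg hK S.mul_pos.le S.primitive_primitive_mono.mono S.primitive_primitive_mono.nonneg
    (fun r => ofReal_mul_primitive_primitive_coneDensity S.nu_nonneg S.mul_pos.le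
      S.primitive_mono.mono r) hh
  obtain ⟨-, h2⟩ := S.radial_isEquivalent hK (u := fun r => r ^ 2 * ρ r ^ 2) (by fun_prop)
    (by simp) S.primitive_primitive_mono (by simp)
    (S.gamma.isEquivalent_primitive_primitive S.g_nonneg (monotone_coneDensity S.mul_pos.le)
      (fun _ => coneDensity_of_nonpos) fun _ => S.ae_abs_sub_coneDensity_le)
  have h3 := kernel_isEquivalent (μ := (volume : Measure (ℝ × ℝ)).prod ν) (T := coneRadius)
    (F := fun x => p 0 * q 0 * (x.1.1 * x.1.2 * ((p x.1.1 - p (-x.1.1)) / (2 * p') *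
        ((q x.1.2 - q (-x.1.2)) / (2 * q')))))
    (F' := fun x => p 0 * q 0 * (x.1.1 ^ (2 * 1) * x.1.2 ^ (2 * 1))) hK
    measurable_coneRadius (Measurable.aestronglyMeasurable (by fun_prop)) ?_ ?_
  · have h4 := (h3.congr_right (by
      filter_upwards [self_mem_nhdsWithin] with h hh
      exact (hcone h hh).2)).trans h2
    have h5 := h4.mul (IsEquivalent.refl (u := fun _ : ℝ => p' / p 0 * (q' / q 0)))
    refine h5.congr_left ?_
    filter_upwards [self_mem_nhdsWithin] with h hh
    simp only [Pi.mul_apply]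
    rw [S.integral_antisymm hK hh, ← integral_mul_const]
    refine integral_congr_ae (Eventually.of_forall fun x => ?_)
    simp only
    field_simp
  · intro ε hε
    have hη : 0 < min 1 (ε / 3) := lt_min one_pos (by positivity)
    obtain ⟨δ₁, hδ₁, h₁⟩ := exists_abs_oddPart_sub_le S.deriv_p hp' hη
    obtain ⟨δ₂, hδ₂, h₂⟩ := exists_abs_oddPart_sub_le S.deriv_q hq' hη
    refine ⟨min δ₁ δ₂, lt_min hδ₁ hδ₂, ?_⟩
    filter_upwards [ae_cone_nonneg S.nu_nonneg] with x hx _ hxδ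
    have h6 := abs_le_coneRadius hx
    have h7 := abs_mul_mul_sub_le (ε := ε) hη.le (min_le_left _ _)
      (by linarith [min_le_right 1 (ε / 3)])
      (h₁ x.1.1 ((h6.1.trans_lt hxδ).trans_le (min_le_left _ _)))
      (h₂ x.1.2 ((h6.2.trans_lt hxδ).trans_le (min_le_right _ _)))
    simp only [mul_one]
    rw [← mul_sub, abs_mul, abs_of_pos S.mul_pos, mul_left_comm ε]
    exact mul_le_mul_of_nonneg_left h7 S.mul_pos.le
  · filter_upwards [self_mem_nhdsWithin] with h hh
    exact (hcone h hh).1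

end ConeSetting

/-! ### The kernel and the coordinates of `X - x₀` -/

/-- Cutting off to `[0, 1]` discards the uncontrolled values on the negative axis; continuity on the
interval gives measurability. -/
theorem LocalPCA.AssumptionTwo.isBoundedKernel {K : ℝ → ℝ} (hK : LocalPCA.AssumptionTwo K) :
    IsBoundedKernel ((Set.Icc 0 1).indicator K) where
  measurable := by
    classical
    have := ContinuousOn.measurable_piecewise (s := Set.Icc (0 : ℝ) 1)
      hK.differentiable.continuousOn
      (continuousOn_const (c := (0 : ℝ))) measurableSet_Icc
    rwa [← Set.piecewise_eq_indicator]
  nonneg := fun s => Set.indicator_nonneg (fun t ht => hK.nonneg t ht.1) s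
  bounded := by
    obtain ⟨C, hC⟩ := hK.bounded
    refine ⟨C, fun s => ?_⟩
    by_cases hs : s ∈ Set.Icc (0 : ℝ) 1
    · rw [Set.indicator_of_mem hs]
      exact hC s hs.1
    · rw [Set.indicator_of_notMem hs]
      exact (hK.nonneg 0 le_rfl).trans (hC 0 le_rfl)
  support := fun s hs => Set.mem_Icc.1 (Set.mem_of_indicator_ne_zero hs)

theorem LocalPCA.AssumptionTwo.indicator_eq {K : ℝ → ℝ} (hK : LocalPCA.AssumptionTwo K) {s : ℝ}
    (hs : 0 ≤ s) : (Set.Icc 0 1).indicator K s = K s := by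
  by_cases h1 : s ≤ 1
  · exact Set.indicator_of_mem (Set.mem_Icc.2 ⟨hs, h1⟩) K
  · rw [hK.support s (not_le.1 h1), Set.indicator_of_notMem fun h => h1 h.2]

section Coordinates

variable {Ω : Type*} {H : Type*} [NormedAddCommGroup H] [InnerProductSpace ℝ H]

/-- The squared norm of the part of `Y` orthogonal to two of the basis vectors. -/
noncomputable def residualSq (e : HilbertBasis ℕ ℝ H) (Y : Ω → H) (i j : ℕ) (ω : Ω) : ℝ :=
  (∑' k, ENNReal.ofReal (if k = i ∨ k = j then 0 else (inner ℝ (Y ω) (e k)) ^ 2)).toReal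

/-- Two coordinates of `Y` and the squared norm of the remaining part. -/
noncomputable def coneCoordinates (e : HilbertBasis ℕ ℝ H) (Y : Ω → H) (i j : ℕ) (ω : Ω) :
    (ℝ × ℝ) × ℝ :=
  ((inner ℝ (Y ω) (e i), inner ℝ (Y ω) (e j)), residualSq e Y i j ω)

theorem residualSq_eq (e : HilbertBasis ℕ ℝ H) (Y : Ω → H) {i j : ℕ} (hij : i ≠ j) (ω : Ω) :
    residualSq e Y i j ω =
      ‖Y ω‖ ^ 2 - inner ℝ (Y ω) (e i) ^ 2 - inner ℝ (Y ω) (e j) ^ 2 := by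
  have h1 : HasSum (fun k => inner ℝ (Y ω) (e k) ^ 2) (‖Y ω‖ ^ 2) := by
    have := e.hasSum_inner_mul_inner (Y ω) (Y ω)
    rw [real_inner_self_eq_norm_sq] at this
    refine this.congr_fun fun k => ?_
    rw [real_inner_comm (e k) (Y ω), sq]
  have h2 := (h1.update i 0).update j 0
  rw [Function.update_of_ne hij.symm] at h2
  have h3 : Function.update (Function.update (fun k => inner ℝ (Y ω) (e k) ^ 2) i 0) j 0 =
      fun k => if k = i ∨ k = j then 0 else (inner ℝ (Y ω) (e k)) ^ 2 := by
    ext k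
    by_cases hj : k = j
    · simp [hj]
    · by_cases hi : k = i
      · simp [hi, hij]
      · simp [hi, hj]
  rw [h3] at h2
  have h0 : ∀ k, 0 ≤ if k = i ∨ k = j then 0 else (inner ℝ (Y ω) (e k)) ^ 2 := by
    intro k
    split_ifs <;> positivity
  rw [residualSq, ← ENNReal.ofReal_tsum_of_nonneg h0 h2.summable,
    ENNReal.toReal_ofReal (tsum_nonneg h0), h2.tsum_eq]
  ring

theorem coneRadius_coneCoordinates (e : HilbertBasis ℕ ℝ H) (Y : Ω → H) {i j : ℕ} (hij : i ≠ j)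
    (ω : Ω) : coneRadius (coneCoordinates e Y i j ω) = ‖Y ω‖ := by
  simp only [coneRadius, coneCoordinates]
  rw [residualSq_eq e Y hij]
  convert Real.sqrt_sq (norm_nonneg (Y ω)) using 2
  ring

end Coordinates

theorem map_sub_const_eq_withDensity {Ω : Type*} [MeasurableSpace Ω] {P : Measure Ω} {U : Ω → ℝ}
    (hU : Measurable U) {f : ℝ → ℝ} (hf : LocalPCA.HasDensityOn P U f Set.univ) (c : ℝ) :
    P.map (fun ω => U ω - c) = volume.withDensity fun t => ENNReal.ofReal (f (t + c)) := by
  have hlaw := hf.law_eq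
  rw [Measure.restrict_univ, Measure.restrict_univ] at hlaw
  have hs : Measurable fun t : ℝ => t - c := by fun_prop
  have hmf := hf.measurable
  have h1 : P.map (fun ω => U ω - c) = (P.map U).map fun t => t - c :=
    (Measure.map_map hs hU).symm
  rw [h1, hlaw]
  ext B hB
  rw [Measure.map_apply hs hB, withDensity_apply _ (hs hB), withDensity_apply _ hB,
    ← lintegral_indicator (hs hB), ← lintegral_indicator hB,
    ← lintegral_add_right_eq_self _ c]
  refine lintegral_congr fun t => ?_
  by_cases ht : t ∈ B
  · rw [Set.indicator_of_mem ht, Set.indicator_of_mem (by simpa using ht)]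
  · rw [Set.indicator_of_notMem ht, Set.indicator_of_notMem (by simpa using ht)]

/-- The pair of coordinates and the residual are measurable for the σ-algebras generated by disjoint
families of independent coordinates, so the joint law is a product. -/
theorem LocalPCA.AssumptionOne.map_coneCoordinates {Ω : Type*} [MeasurableSpace Ω] {P : Measure Ω}
    [IsProbabilityMeasure P] {H : Type*} [NormedAddCommGroup H] [InnerProductSpace ℝ H]
    [MeasurableSpace H] [BorelSpace H]
    [TopologicalSpace.SeparableSpace H] {X : Ω → H} (hX : Measurable X) {x₀ : H}
    {e : HilbertBasis ℕ ℝ H} {f : ℕ → ℝ → ℝ} {g ρ : ℝ → ℝ}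
    (hA : LocalPCA.AssumptionOne P X x₀ e f g ρ) {i j : ℕ} (hij : i ≠ j) :
    Measurable (coneCoordinates e (fun ω => X ω - x₀) i j) ∧
    P.map (coneCoordinates e (fun ω => X ω - x₀) i j) =
      coneLaw (P.map (residualSq e (fun ω => X ω - x₀) i j))
        (fun t => f i (t + inner ℝ x₀ (e i))) (fun t => f j (t + inner ℝ x₀ (e j))) := by
  have : SecondCountableTopology H := UniformSpace.secondCountable_of_separable H
  have hU : ∀ k, Measurable fun ω => (inner ℝ (X ω) (e k) : ℝ) := fun k => by fun_prop
  set m : ℕ → MeasurableSpace Ω :=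
    fun k => MeasurableSpace.comap (fun ω => (inner ℝ (X ω) (e k) : ℝ)) inferInstance with hm
  have hmle : ∀ k, m k ≤ ‹MeasurableSpace Ω› := fun k => (hU k).comap_le
  have hind : iIndep m P := (iIndepFun_iff_iIndep _ _ _).1 hA.indep
  have hmeas : ∀ (A : Set ℕ) k, k ∈ A → Measurable[⨆ l ∈ A, m l]
      fun ω => (inner ℝ (X ω - x₀) (e k) : ℝ) := by
    intro A k hk
    have h1 : Measurable[⨆ l ∈ A, m l] fun ω => (inner ℝ (X ω) (e k) : ℝ) :=
      (comap_measurable _).mono (le_biSup m hk) le_rfl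
    simp only [inner_sub_left]
    exact h1.sub_const _
  have hmleA : ∀ A : Set ℕ, ⨆ l ∈ A, m l ≤ ‹MeasurableSpace Ω› := fun A =>
    iSup₂_le fun k _ => hmle k
  have hpair : Measurable[⨆ l ∈ ({i, j} : Set ℕ), m l] fun ω =>
      ((inner ℝ (X ω - x₀) (e i) : ℝ), (inner ℝ (X ω - x₀) (e j) : ℝ)) :=
    (hmeas _ i (by simp)).prodMk (hmeas _ j (by simp))
  -- Because the residual is defined as a sum over the other coordinates, not as a difference of
  -- squared norms, its measurability for their σ-algebra is direct.
  have hres : Measurable[⨆ l ∈ ({i, j}ᶜ : Set ℕ), m l]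
      (residualSq e (fun ω => X ω - x₀) i j) := by
    have hsum : Measurable fun a : ℕ → ENNReal => ∑' k, a k := Measurable.tsum measurable_pi_apply
    refine Measurable.ennreal_toReal (hsum.comp (@measurable_pi_lambda _ _ _ (_) _ _ fun k => ?_))
    by_cases hk : k = i ∨ k = j
    · simp [hk]
    · simp only [hk, if_false]
      exact ((hmeas _ k (by simpa using hk)).pow_const 2).ennreal_ofReal
  have hpair' := hpair.mono (hmleA _) le_rfl
  have hres' := hres.mono (hmleA _) le_rfl
  refine ⟨hpair'.prodMk hres', ?_⟩
  have hindep : IndepFun (fun ω =>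
      ((inner ℝ (X ω - x₀) (e i) : ℝ), (inner ℝ (X ω - x₀) (e j) : ℝ)))
      (residualSq e (fun ω => X ω - x₀) i j) P := by
    rw [IndepFun_iff_Indep]
    exact indep_of_indep_of_le_right (indep_of_indep_of_le_left
      (indep_iSup_of_disjoint hmle hind disjoint_compl_right) hpair.comap_le) hres.comap_le
  have hindep2 : IndepFun (fun ω => (inner ℝ (X ω - x₀) (e i) : ℝ))
      (fun ω => (inner ℝ (X ω - x₀) (e j) : ℝ)) P := by
    have := (hA.indep.indepFun hij).comp
      (measurable_id.sub_const (inner ℝ x₀ (e i) : ℝ))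
      (measurable_id.sub_const (inner ℝ x₀ (e j) : ℝ))
    simpa only [Function.comp_def, id, ← inner_sub_left] using this
  have hlaw : ∀ k, P.map (fun ω => (inner ℝ (X ω - x₀) (e k) : ℝ)) =
      volume.withDensity fun t => ENNReal.ofReal (f k (t + inner ℝ x₀ (e k))) := by
    intro k
    simp only [inner_sub_left]
    exact map_sub_const_eq_withDensity (hU k) (hA.density k) _
  have hfm : ∀ k, Measurable fun t => ENNReal.ofReal (f k (t + inner ℝ x₀ (e k))) := by
    intro k
    have := (hA.density k).measurable
    fun_prop
  have hY : ∀ k, Measurable fun ω => (inner ℝ (X ω - x₀) (e k) : ℝ) := fun k => by fun_prop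
  have h1 := (indepFun_iff_map_prod_eq_prod_map_map hpair'.aemeasurable hres'.aemeasurable).1 hindep
  have h2 := (indepFun_iff_map_prod_eq_prod_map_map (hY i).aemeasurable (hY j).aemeasurable).1
    hindep2
  have hpq : Measurable fun x : ℝ × ℝ => ENNReal.ofReal (f i (x.1 + inner ℝ x₀ (e i))) *
      ENNReal.ofReal (f j (x.2 + inner ℝ x₀ (e j))) :=
    ((hfm i).comp measurable_fst).mul ((hfm j).comp measurable_snd)
  change P.map (fun ω => (_, _)) = _
  have : IsProbabilityMeasure (P.map (residualSq e (fun ω => X ω - x₀) i j)) :=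
    Measure.isProbabilityMeasure_map hres'.aemeasurable
  rw [h1, h2, hlaw i, hlaw j, prod_withDensity (hfm i) (hfm j), ← Measure.volume_eq_prod,
    prod_withDensity_left hpq, coneLaw]
  congr 1
  ext x
  exact (ENNReal.ofReal_mul ((hA.density i).nonneg _)).symm

theorem LocalPCA.AssumptionOne.coneSetting {Ω : Type*} [MeasurableSpace Ω] {P : Measure Ω}
    [IsProbabilityMeasure P] {H : Type*} [NormedAddCommGroup H] [InnerProductSpace ℝ H]
    [MeasurableSpace H] [BorelSpace H]
    [TopologicalSpace.SeparableSpace H] {X : Ω → H} (hX : Measurable X) {x₀ : H}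
    {e : HilbertBasis ℕ ℝ H} {f : ℕ → ℝ → ℝ} {g ρ : ℝ → ℝ}
    (hA : LocalPCA.AssumptionOne P X x₀ e f g ρ) {i j : ℕ} (hij : i ≠ j) :
    ConeSetting (P.map (residualSq e (fun ω => X ω - x₀) i j))
      (fun t => f i (t + inner ℝ x₀ (e i))) (fun t => f j (t + inner ℝ x₀ (e j)))
      (deriv (f i) (inner ℝ x₀ (e i))) (deriv (f j) (inner ℝ x₀ (e j))) g ρ := by
  obtain ⟨hm, hlaw⟩ := hA.map_coneCoordinates hX hij
  have hd : ∀ k, HasDerivAt (fun t => f k (t + inner ℝ x₀ (e k)))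
      (deriv (f k) (inner ℝ x₀ (e k))) 0 := by
    intro k
    have h1 := (hA.differentiable k).self_of_nhds.hasDerivAt
    rw [← zero_add (inner ℝ x₀ (e k))] at h1
    have := h1.comp_add_const 0 (inner ℝ x₀ (e k))
    rwa [zero_add] at this
  have hmf : ∀ k, Measurable fun t => f k (t + inner ℝ x₀ (e k)) := fun k =>
    (hA.density k).measurable.comp (measurable_id.add_const _)
  refine ⟨?_, hmf i, hmf j, fun _ => (hA.density i).nonneg _, fun _ => (hA.density j).nonneg _,
    by simpa using hA.ne_zero i, by simpa using hA.ne_zero j, hd i, hd j, hA.deriv_ne_zero i,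
    hA.deriv_ne_zero j, ?_, ?_, hA.gamma⟩
  · have hres : Measurable (residualSq e (fun ω => X ω - x₀) i j) := measurable_snd.comp hm
    rw [ae_map_iff hres.aemeasurable measurableSet_Ici]
    exact Eventually.of_forall fun ω => ENNReal.toReal_nonneg
  · rw [← hlaw]
    infer_instance
  · obtain ⟨ε, hε, h⟩ := hA.density_norm
    refine ⟨ε, hε, h.measurable, h.nonneg, ?_⟩
    rw [← hlaw, Measure.map_map measurable_coneRadius hm, ← h.law_eq]
    simp only [Function.comp_def, coneRadius_coneCoordinates e _ hij]

/-! ### The local covariance operator -/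

section LocalCov

variable {Ω : Type*} {H : Type*} [NormedAddCommGroup H] [InnerProductSpace ℝ H]
  {X : Ω → H} {x₀ : H} {K : ℝ → ℝ}

/-- On the support of the kernel `‖X - x₀‖ ≤ h`, and `u ⊗ u` has norm `‖u‖²`. The bound yields both
integrability and convergence to `0`. -/
theorem LocalPCA.AssumptionTwo.exists_norm_localTensor_le (hK : LocalPCA.AssumptionTwo K) :
    ∃ C, ∀ h, 0 < h → ∀ ω, ‖LocalPCA.localTensor K X x₀ h ω‖ ≤ C * h ^ 2 := by
  obtain ⟨C, hC⟩ := hK.bounded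
  have hC0 : 0 ≤ C := (hK.nonneg 0 le_rfl).trans (hC 0 le_rfl)
  refine ⟨C, fun h hh ω => ?_⟩
  have hr : 0 ≤ ‖X ω - x₀‖ / h := by positivity
  rw [LocalPCA.localTensor, norm_smul, InnerProductSpace.norm_rankOne,
    Real.norm_of_nonneg (hK.nonneg _ hr), ← sq]
  by_cases h1 : ‖X ω - x₀‖ / h ≤ 1
  · rw [div_le_one hh] at h1
    exact mul_le_mul (hC _ hr) (by gcongr) (by positivity) hC0
  · rw [hK.support _ (not_le.1 h1), zero_mul]
    positivity

variable [MeasurableSpace Ω] {P : Measure Ω}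

theorem LocalPCA.AssumptionTwo.integrable_localTensor [IsProbabilityMeasure P] [MeasurableSpace H] [BorelSpace H]
    [TopologicalSpace.SeparableSpace H] (hK : LocalPCA.AssumptionTwo K) (hX : Measurable X)
    {h : ℝ} (hh : 0 < h) : Integrable (LocalPCA.localTensor K X x₀ h) P := by
  have : SecondCountableTopology H := UniformSpace.secondCountable_of_separable H
  obtain ⟨C, hC⟩ := hK.exists_norm_localTensor_le (X := X) (x₀ := x₀)
  refine Integrable.of_bound (C := C * h ^ 2) ?_ (Eventually.of_forall (hC h hh))
  have h1 : LocalPCA.localTensor K X x₀ h = fun ω =>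
      (Set.Icc 0 1).indicator K (‖X ω - x₀‖ / h) •
        InnerProductSpace.rankOne ℝ (X ω - x₀) (X ω - x₀) := by
    ext1 ω
    rw [hK.indicator_eq (by positivity), LocalPCA.localTensor]
  have hKm := hK.isBoundedKernel.measurable
  have hY : Measurable fun ω => X ω - x₀ := hX.sub_const x₀
  have hc : Continuous fun u : H => InnerProductSpace.rankOne ℝ u u :=
    (InnerProductSpace.rankOne ℝ).continuous.clm_apply continuous_id
  rw [h1]
  exact ((hKm.comp (hY.norm.div_const h)).stronglyMeasurable.smul
    (hc.comp_stronglyMeasurable hY.stronglyMeasurable)).aestronglyMeasurable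

theorem LocalPCA.AssumptionTwo.tendsto_localCov [IsProbabilityMeasure P] (hK : LocalPCA.AssumptionTwo K) :
    Tendsto (fun h => LocalPCA.localCov P K X x₀ h) (𝓝[>] 0) (𝓝 0) := by
  obtain ⟨C, hC⟩ := hK.exists_norm_localTensor_le (X := X) (x₀ := x₀)
  have h0 : Tendsto (fun h : ℝ => C * h ^ 2) (𝓝[>] 0) (𝓝 0) := by
    have : Tendsto (fun h : ℝ => C * h ^ 2) (𝓝 0) (𝓝 (C * 0 ^ 2)) :=
      Continuous.tendsto (by fun_prop) 0
    rw [zero_pow two_ne_zero, mul_zero] at this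
    exact tendsto_nhdsWithin_of_tendsto_nhds this
  refine squeeze_zero_norm' ?_ h0
  filter_upwards [self_mem_nhdsWithin] with h hh
  have := norm_integral_le_of_norm_le_const (μ := P) (Eventually.of_forall (hC h hh))
  rw [LocalPCA.localCov]
  simpa using this

theorem inner_localCov [CompleteSpace H] {h : ℝ}
    (hi : Integrable (LocalPCA.localTensor K X x₀ h) P) (a b : H) :
    inner ℝ (LocalPCA.localCov P K X x₀ h a) b =
      ∫ ω, K (‖X ω - x₀‖ / h) * (inner ℝ (X ω - x₀) a * inner ℝ (X ω - x₀) b) ∂P := by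
  rw [LocalPCA.localCov, ContinuousLinearMap.integral_apply hi, real_inner_comm,
    ← integral_inner (hi.apply_continuousLinearMap a)]
  refine integral_congr_ae (Eventually.of_forall fun ω => ?_)
  simp only [LocalPCA.localTensor, smul_apply,
    InnerProductSpace.rankOne_apply, inner_smul_right, real_inner_comm b]

end LocalCov

/-! ### The asymptotics of the matrix cells -/

theorem theorem1
    {Ω : Type*} [MeasurableSpace Ω] (P : Measure Ω) [IsProbabilityMeasure P]
    {H : Type*} [NormedAddCommGroup H] [InnerProductSpace ℝ H] [CompleteSpace H]
    [TopologicalSpace.SeparableSpace H] [MeasurableSpace H] [BorelSpace H]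
    (X : Ω → H) (hX : Measurable X) (x₀ : H) (e : HilbertBasis ℕ ℝ H)
    (f : ℕ → ℝ → ℝ) (g ρ K : ℝ → ℝ)
    (hA1 : LocalPCA.AssumptionOne P X x₀ e f g ρ)
    (hA2 : LocalPCA.AssumptionTwo K) :
    -- the expectations are well defined
    (∀ h : ℝ, 0 < h → Integrable (LocalPCA.localTensor K X x₀ h) P) ∧
    (∀ᶠ h in 𝓝[>] (0 : ℝ), Integrable (LocalPCA.vInner K ρ X x₀ h) P ∧
      Integrable (LocalPCA.wInner K ρ X x₀ h) P ∧
      0 ≤ LocalPCA.v P K ρ X x₀ h ∧ 0 ≤ LocalPCA.w P K ρ X x₀ h) ∧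
    -- convergence to zero in operator norm
    Tendsto (fun h => LocalPCA.localCov P K X x₀ h) (𝓝[>] 0) (𝓝 0) ∧
    -- asymptotic equivalence of each cell
    ∀ i j : ℕ,
      (fun h => inner ℝ (LocalPCA.localCov P K X x₀ h (e i)) (e j)) ~[𝓝[>] 0]
        (fun h => LocalPCA.v P K ρ X x₀ h * (if i = j then 1 else 0) +
          LocalPCA.w P K ρ X x₀ h * LocalPCA.R f x₀ e i j) := by
  have hK := hA2.isBoundedKernel
  have hKm := hK.measurable
  have hρ := hA1.gamma.measurable_aux
  have hR := measurable_coneRadius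
  have hten : ∀ h : ℝ, 0 < h → Integrable (LocalPCA.localTensor K X x₀ h) P := fun h hh =>
    hA2.integrable_localTensor hX hh
  -- transfer of expectations of functions of the cone coordinates
  have htr : ∀ {i j : ℕ}, i ≠ j → ∀ {h : ℝ}, 0 < h → ∀ {φ : (ℝ × ℝ) × ℝ → ℝ}, Measurable φ →
      (∫ x, (Set.Icc 0 1).indicator K (coneRadius x / h) * φ x
        ∂coneLaw (P.map (residualSq e (fun ω => X ω - x₀) i j))
          (fun t => f i (t + inner ℝ x₀ (e i))) (fun t => f j (t + inner ℝ x₀ (e j))) =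
        ∫ ω, K (‖X ω - x₀‖ / h) * φ (coneCoordinates e (fun ω => X ω - x₀) i j ω) ∂P) ∧
      (Integrable (fun x => (Set.Icc 0 1).indicator K (coneRadius x / h) * φ x)
        (coneLaw (P.map (residualSq e (fun ω => X ω - x₀) i j))
          (fun t => f i (t + inner ℝ x₀ (e i))) (fun t => f j (t + inner ℝ x₀ (e j)))) →
        Integrable
          (fun ω => K (‖X ω - x₀‖ / h) * φ (coneCoordinates e (fun ω => X ω - x₀) i j ω)) P) := by
    intro i j hij h hh φ hφ
    obtain ⟨hm, hlaw⟩ := hA1.map_coneCoordinates hX hij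
    have hψ : Measurable fun x => (Set.Icc 0 1).indicator K (coneRadius x / h) * φ x := by fun_prop
    have hfun : ∀ ω, (Set.Icc 0 1).indicator K
        (coneRadius (coneCoordinates e (fun ω => X ω - x₀) i j ω) / h) =
        K (‖X ω - x₀‖ / h) := by
      intro ω
      rw [coneRadius_coneCoordinates e _ hij, hA2.indicator_eq (by positivity)]
    rw [← hlaw]
    constructor
    · rw [integral_map hm.aemeasurable hψ.aestronglyMeasurable]
      simp only [hfun]
    · intro hi
      have := (integrable_map_measure hψ.aestronglyMeasurable hm.aemeasurable).1 hi
      simpa only [Function.comp_def, hfun] using this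
  have hv : ∀ {i j : ℕ}, i ≠ j → ∀ {h : ℝ}, 0 < h → _ := fun {i j} hij {h} hh =>
    htr hij hh (φ := fun x => coneRadius x * ρ (coneRadius x)) (by fun_prop)
  have hw : ∀ {i j : ℕ}, i ≠ j → ∀ {h : ℝ}, 0 < h → _ := fun {i j} hij {h} hh =>
    htr hij hh (φ := fun x => coneRadius x ^ 2 * ρ (coneRadius x) ^ 2) (by fun_prop)
  have hprob : ∀ {i j : ℕ}, i ≠ j →
      IsFiniteMeasure (P.map (residualSq e (fun ω => X ω - x₀) i j)) := fun _ => inferInstance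
  refine ⟨hten, ?_, hA2.tendsto_localCov, ?_⟩
  · have h01 : (0 : ℕ) ≠ 1 := zero_ne_one
    have S := hA1.coneSetting hX h01
    obtain ⟨δ, hδ, hpos⟩ := mem_nhdsGT_iff_exists_Ioo_subset.1 hA1.gamma.aux_pos
    filter_upwards [(S.first_moment hK).1, (S.second_isLittleO_first hK).1, Ioo_mem_nhdsGT hδ]
      with h h1 h2 h3
    have hi1 := (hv h01 h3.1).2 h1
    have hi2 := (hw h01 h3.1).2 h2
    simp only [coneRadius_coneCoordinates e _ h01] at hi1 hi2
    refine ⟨hi1, hi2, integral_nonneg fun ω => ?_, integral_nonneg fun ω => ?_⟩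
    · simp only [LocalPCA.vInner, Pi.zero_apply]
      have hr : 0 ≤ ‖X ω - x₀‖ / h := div_nonneg (norm_nonneg _) h3.1.le
      by_cases hr1 : ‖X ω - x₀‖ / h ≤ 1
      · rw [div_le_one h3.1] at hr1
        -- Positivity of `ρ` is known only to the right of `0`; at radius `0` the product vanishes.
        rcases (norm_nonneg (X ω - x₀)).eq_or_lt with h0 | h0
        · simp [← h0]
        · have h4 : 0 < ρ ‖X ω - x₀‖ := hpos ⟨h0, hr1.trans_lt h3.2⟩
          exact mul_nonneg (hA2.nonneg _ hr) (mul_nonneg (norm_nonneg _) h4.le)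
      · rw [hA2.support _ (not_le.1 hr1), zero_mul]
    · exact mul_nonneg (hA2.nonneg _ (div_nonneg (norm_nonneg _) h3.1.le)) (by positivity)
  · intro i j
    by_cases hij : i = j
    · subst hij
      -- The cone needs a second coordinate; `i + 1` is an arbitrary partner.
      have h01 : i ≠ i + 1 := (Nat.succ_ne_self i).symm
      have S := hA1.coneSetting hX h01
      have h1 : (fun h => inner ℝ (LocalPCA.localCov P K X x₀ h (e i)) (e i)) ~[𝓝[>] 0]
          fun h => LocalPCA.v P K ρ X x₀ h := by
        refine ((S.first_moment hK).2.congr_left ?_).congr_right ?_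
        · filter_upwards [self_mem_nhdsWithin] with h hh
          rw [inner_localCov (hten h hh), (htr h01 hh (φ := fun x => x.1.1 ^ 2) (by fun_prop)).1]
          simp only [coneCoordinates, sq]
        · filter_upwards [self_mem_nhdsWithin] with h hh
          rw [(hv h01 hh).1]
          simp only [coneRadius_coneCoordinates e _ h01]
          rfl
      have h2 : (fun h => LocalPCA.w P K ρ X x₀ h) =o[𝓝[>] 0]
          fun h => LocalPCA.v P K ρ X x₀ h := by
        refine (S.second_isLittleO_first hK).2.congr' ?_ ?_
        · filter_upwards [self_mem_nhdsWithin] with h hh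
          rw [(hw h01 hh).1]
          simp only [coneRadius_coneCoordinates e _ h01]
          rfl
        · filter_upwards [self_mem_nhdsWithin] with h hh
          rw [(hv h01 hh).1]
          simp only [coneRadius_coneCoordinates e _ h01]
          rfl
      have h3 : (fun h => LocalPCA.w P K ρ X x₀ h * LocalPCA.R f x₀ e i i) =o[𝓝[>] 0]
          fun h => LocalPCA.v P K ρ X x₀ h := by
        simpa only [mul_comm] using h2.const_mul_left (LocalPCA.R f x₀ e i i)
      refine h1.trans ?_
      simp only [if_true, mul_one]
      exact (IsEquivalent.refl.add_isLittleO h3).symm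
    · have S := hA1.coneSetting hX hij
      simp only [hij, if_false, mul_zero, zero_add, LocalPCA.R]
      refine ((S.mixed_moment hK).congr_left ?_).congr_right ?_
      · filter_upwards [self_mem_nhdsWithin] with h hh
        rw [inner_localCov (hten h hh), (htr hij hh (φ := fun x => x.1.1 * x.1.2) (by fun_prop)).1]
        simp only [coneCoordinates]
      · filter_upwards [self_mem_nhdsWithin] with h hh
        rw [(hw hij hh).1]
        simp only [coneRadius_coneCoordinates e _ hij, zero_add]
        rfl
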